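/- **Setting.** Let $d\ge 1$, let $D\subset\mathbb R^d$ be a bounded open set, $V=H^1_0(D)$ (real valued; the closure of $C_c^\infty(D)$ in $H^1(D)$) with dual $V^*$, and $f\in V^*$. For $u\in L^\infty(D)$ bounded below by a positive constant let $G(u)=p\in V$ be the weak solution of $-\nabla\cdot(u\nabla p)=f$ in $D$, $p=0$ on $\partial D$, i.e. $\int_D u\nabla p\cdot\nabla q\,dx=\langle q,f\rangle$ for all $q\in V$. Let $o_1,\dots,o_n\in V^*$, $\mathcal G(u)=(o_k(G(u)))_{k=1}^n\in\mathbb R^n$, let $\delta\in\mathbb R^n$ be given data and $\Gamma\in\mathbb R^{n\times n}$ a symmetric positive definite matrix, and put $\Phi(u;\delta)=\tfrac12(\delta-\mathcal G(u))^\top\Gamma^{-1}(\delta-\mathcal G(u))$. Let $\mathbb J\subset\mathbb N$ (for instance $\{1,\dots,J\}$ or $\{1,2,\dots\}$), $U=[-1,1]^{\mathbb J}$, and let $\mu_0=\bigotimes_{j\in\mathbb J}\frac{dy_j}{2}$ be the uniform probability measure on $U$. Let $\bar a,\psi_j\in L^\infty(D)$ $(j\in\mathbb J)$ be real valued with $\sum_{j\in\mathbb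 J}\|\psi_j\|_{L^\infty(D)}<\infty$, put $u(y)=\bar a+\sum_{j\in\mathbb J}y_j\psi_j$, and assume that there are constants $a_{\min},a_{\max}$ such that, for every $y\in U$, $0<a_{\min}\le u(y)\le a_{\max}<\infty$ almost everywhere in $D$. Let $\Theta(y)=\exp(-\Phi(u(y);\delta))$ for $y\in U$. Let $\mathcal F$ be the set of finitely supported $\nu\in\mathbb N_0^{\mathbb J}$ and $\operatorname{supp}\nu=\{j:\nu_j\neq0\}$. Let $L_k$ be the Legendre polynomials normalized by $\int_{-1}^1L_k(t)^2\frac{dt}2=1$, $L_\nu(y)=\prod_{j\in\operatorname{supp}\nu}L_{\nu_j}(y_j)$, and let $\theta_\nu=\int_U\Theta(y)L_\nu(y)\,\mu_0(dy)$ for $\nu\in\mathcal F$. Fix $K\in(0,1)$ with $K\sum_{j\in\mathbb J}\|\psi_j\|_{L^\infty(D)}<\frac{a_{\min}}8$ and $J_0\in\mathbb N_0$ with $\sum_{j>J_0}\|\psi_j\|_{L^\infty(D)}<\frac{a_{\min}K}{24(1+K)}$. For $\nu\in\mathcal F$ put $|\nu_F|=\sum_{j>J_0}\nu_j$ and $$r_m=K\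 \ (m\le J_0),\qquad r_m=1+\frac{a_{\min}\,\nu_m}{4|\nu_F|\,\|\psi_m\|_{L^\infty(D)}}\ \ (m>J_0),\qquad \eta_m=r_m+\sqrt{1+r_m^2},$$ where the fraction is read as $0$ whenever its denominator vanishes. **Proposition 5.1.** There is a constant $C>0$ such that for every $\nu\in\mathcal F$ the function $\Theta L_\nu$ is $\mu_0$-integrable on $U$ and $$|\theta_\nu|\le C\prod_{m\in\operatorname{supp}\nu}\frac{2(1+K)}K\,\eta_m^{-\nu_m}.$$ Moreover, if $\psi_m=0$ for some $m\in\operatorname{supp}\nu$ with $m>J_0$ (the case in which the formula for $r_m$ would give $r_m=\infty$), then $\theta_\nu=0$. -/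

import Mathlib

open MeasureTheory
open scoped ENNReal ContDiff

namespace BayesElliptic

/-! ### The energy space `V = H¹₀(D)` and the forward problem -/

/-- Lebesgue measure on `D ⊆ ℝᵈ`. -/
noncomputable abbrev volOn {d : ℕ} (D : Set (EuclideanSpace ℝ (Fin d))) :
    Measure (EuclideanSpace ℝ (Fin d)) :=
  volume.restrict D

/-- `X = L^∞(D)`, real valued, with the essential supremum norm. -/
noncomputable abbrev LInf {d : ℕ} (D : Set (EuclideanSpace ℝ (Fin d))) : Type :=
  Lp ℝ ∞ (volOn D)

/-- The Hilbert space `L²(D) × L²(D; ℝᵈ)`, whose norm restricted to pairs `(v, ∇v)` is the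
`H¹(D)` norm. -/
noncomputable abbrev L2Pair {d : ℕ} (D : Set (EuclideanSpace ℝ (Fin d))) : Type :=
  WithLp 2 (Lp ℝ 2 (volOn D) × Lp (EuclideanSpace ℝ (Fin d)) 2 (volOn D))

/-- The space of pairs `(φ, ∇φ)` with `φ ∈ C_c^∞(D)`. -/
noncomputable def testPairs {d : ℕ} (D : Set (EuclideanSpace ℝ (Fin d))) :
    Submodule ℝ (L2Pair D) where
  carrier := {w | ∃ φ : EuclideanSpace ℝ (Fin d) → ℝ,
    ContDiff ℝ ∞ φ ∧ HasCompactSupport φ ∧ tsupport φ ⊆ D ∧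
      w.fst =ᵐ[volOn D] φ ∧ w.snd =ᵐ[volOn D] fun x => gradient φ x}
  add_mem' := by
    rintro v w ⟨φ, hφ, hφc, hφD, hv1, hv2⟩ ⟨χ, hχ, hχc, hχD, hw1, hw2⟩
    refine ⟨φ + χ, hφ.add hχ, hφc.add hχc,
      (tsupport_add φ χ).trans (Set.union_subset hφD hχD), ?_, ?_⟩
    · filter_upwards [Lp.coeFn_add v.fst w.fst, hv1, hw1] with x h h1 h2
      rw [WithLp.add_fst, h, Pi.add_apply, Pi.add_apply, h1, h2]
    · filter_upwards [Lp.coeFn_add v.snd w.snd, hv2, hw2] with x h h1 h2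
      rw [WithLp.add_snd, h, Pi.add_apply, h1, h2]
      simp only [gradient]
      rw [fderiv_add (hφ.differentiable (by simp) x) (hχ.differentiable (by simp) x), map_add]
  zero_mem' := by
    refine ⟨0, contDiff_const, HasCompactSupport.zero, by simp, ?_, ?_⟩
    · exact Lp.coeFn_zero _ _ _
    · filter_upwards [Lp.coeFn_zero (EuclideanSpace ℝ (Fin d)) 2 (volOn D)] with x h
      rw [WithLp.zero_snd, h]
      simp [gradient]
  smul_mem' := by
    rintro c w ⟨φ, hφ, hφc, hφD, hw1, hw2⟩
    refine ⟨c • φ, hφ.const_smul c, hφc.smul_left (f := fun _ => c),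
      (tsupport_smul_subset_right (fun _ => c) φ).trans hφD, ?_, ?_⟩
    · filter_upwards [Lp.coeFn_smul c w.fst, hw1] with x h h1
      rw [WithLp.smul_fst, h, Pi.smul_apply, Pi.smul_apply, h1]
    · filter_upwards [Lp.coeFn_smul c w.snd, hw2] with x h h1
      rw [WithLp.smul_snd, h, Pi.smul_apply, h1]
      simp only [gradient]
      rw [fderiv_const_smul (hφ.differentiable (by simp) x), map_smul]

/-- `V = H¹₀(D)`: the closure of `C_c^∞(D)` in `H¹(D)`, an element `v` being represented by the
pair `(v, ∇v)`. On a bounded set `D` the norm `‖∇v‖_{L²}` is equivalent to the norm used here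
(Poincaré), so that both norms have the same bounded linear functionals `V*`. -/
noncomputable def H10 {d : ℕ} (D : Set (EuclideanSpace ℝ (Fin d))) : Submodule ℝ (L2Pair D) :=
  (testPairs D).topologicalClosure

/-- The weak gradient `∇v` of `v ∈ H¹₀(D)`. -/
noncomputable def weakGrad {d : ℕ} {D : Set (EuclideanSpace ℝ (Fin d))} (v : H10 D) :
    Lp (EuclideanSpace ℝ (Fin d)) 2 (volOn D) :=
  (v : L2Pair D).snd

/-- `p ∈ V` is a weak solution of `-∇·(u ∇p) = f` in `D`, `p = 0` on `∂D`:
`∫_D u ∇p · ∇q dx = ⟨q, f⟩` for all `q ∈ V`. -/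
def IsWeakSolution {d : ℕ} {D : Set (EuclideanSpace ℝ (Fin d))}
    (f : H10 D →L[ℝ] ℝ) (u : LInf D) (p : H10 D) : Prop :=
  ∀ q : H10 D, ∫ x in D, u x * inner ℝ (weakGrad p x) (weakGrad q x) = f q

open Classical in
/-- The forward map `G : u ↦ p`, the weak solution with coefficient `u` (and `0` if there is
none, which does not happen for a uniformly elliptic `u`). -/
noncomputable def forwardMap {d : ℕ} {D : Set (EuclideanSpace ℝ (Fin d))}
    (f : H10 D →L[ℝ] ℝ) (u : LInf D) : H10 D :=
  if h : ∃ p : H10 D, IsWeakSolution f u p then h.choose else 0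

/-- The observation map `𝒢(u) = (o_k(G(u)))_k`. -/
noncomputable def obsMap {d n : ℕ} {D : Set (EuclideanSpace ℝ (Fin d))}
    (f : H10 D →L[ℝ] ℝ) (o : Fin n → (H10 D →L[ℝ] ℝ)) (u : LInf D) : Fin n → ℝ :=
  fun k => o k (forwardMap f u)

/-- The least squares potential `Φ(u; δ) = ½ (δ - 𝒢(u))ᵀ Γ⁻¹ (δ - 𝒢(u))`. -/
noncomputable def potential {d n : ℕ} {D : Set (EuclideanSpace ℝ (Fin d))}
    (f : H10 D →L[ℝ] ℝ) (o : Fin n → (H10 D →L[ℝ] ℝ)) (Γ : Matrix (Fin n) (Fin n) ℝ)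
    (δ : Fin n → ℝ) (u : LInf D) : ℝ :=
  1 / 2 * ((δ - obsMap f o u) ⬝ᵥ (Γ⁻¹).mulVec (δ - obsMap f o u))

/-! ### The parametric coefficient and the posterior density -/

/-- The parameter domain `U = [-1,1]^𝕁`. -/
def paramBox (𝕁 : Set ℕ) : Set (𝕁 → ℝ) := Set.univ.pi fun _ => Set.Icc (-1) 1

/-- The coefficient `u(y) = ā + ∑_{j ∈ 𝕁} y_j ψ_j ∈ L^∞(D)`. -/
noncomputable def coeff {d : ℕ} {D : Set (EuclideanSpace ℝ (Fin d))} {𝕁 : Set ℕ}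
    (abar : LInf D) (ψ : 𝕁 → LInf D) (y : 𝕁 → ℝ) : LInf D :=
  abar + ∑' j, y j • ψ j

/-- The uniform ellipticity assumption `UEA(a_min, a_max)`:
`0 < a_min ≤ u(x,y) ≤ a_max < ∞` for all `y ∈ U` and (almost) all `x ∈ D`. -/
def UEA {d : ℕ} {D : Set (EuclideanSpace ℝ (Fin d))} {𝕁 : Set ℕ}
    (abar : LInf D) (ψ : 𝕁 → LInf D) (amin amax : ℝ) : Prop :=
  0 < amin ∧ ∀ y ∈ paramBox 𝕁, ∀ᵐ x ∂(volOn D), amin ≤ coeff abar ψ y x ∧ coeff abar ψ y x ≤ amax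

/-- The (non-normalized) posterior density `Θ(y) = exp(-Φ(u(y); δ))`. -/
noncomputable def posterior {d n : ℕ} {D : Set (EuclideanSpace ℝ (Fin d))} {𝕁 : Set ℕ}
    (f : H10 D →L[ℝ] ℝ) (o : Fin n → (H10 D →L[ℝ] ℝ)) (Γ : Matrix (Fin n) (Fin n) ℝ)
    (δ : Fin n → ℝ) (abar : LInf D) (ψ : 𝕁 → LInf D) (y : 𝕁 → ℝ) : ℝ :=
  Real.exp (-potential f o Γ δ (coeff abar ψ y))

/-! ### The prior measure and the Legendre coefficients -/

/-- The uniform probability measure `dt/2` on `[-1,1]`. -/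
noncomputable def unif : Measure ℝ := (2⁻¹ : ℝ≥0∞) • volume.restrict (Set.Icc (-1) 1)

instance : IsProbabilityMeasure unif := ⟨by
  rw [unif, Measure.smul_apply, Measure.restrict_apply_univ, Real.volume_Icc, smul_eq_mul]
  norm_num
  exact ENNReal.inv_mul_cancel (by norm_num) (by norm_num)⟩

/-- The prior `μ₀(dy) = ⨂_{j ∈ 𝕁} dy_j/2`, on all of `ℝ^𝕁` and concentrated on `U`. -/
noncomputable def prior (𝕁 : Set ℕ) : Measure (𝕁 → ℝ) := Measure.infinitePi fun _ => unif

/-- The Legendre polynomial `L_k` normalized by `∫_{-1}^1 L_k(t)² dt/2 = 1`, i.e.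
`√(2k+1)` times Rodrigues' formula `P_k = (2^k k!)⁻¹ dᵏ/dtᵏ (t² - 1)^k`. -/
noncomputable def legendre (k : ℕ) : Polynomial ℝ :=
  Polynomial.C (Real.sqrt (2 * k + 1) / (2 ^ k * (k.factorial : ℝ))) *
    Polynomial.derivative^[k] ((Polynomial.X ^ 2 - 1) ^ k)

/-- The tensorized Legendre polynomial `L_ν(y) = ∏_j L_{ν_j}(y_j)` (note `L_0 = 1`). -/
noncomputable def legendreTensor {𝕁 : Set ℕ} (ν : 𝕁 →₀ ℕ) (y : 𝕁 → ℝ) : ℝ :=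
  ∏ j ∈ ν.support, (legendre (ν j)).eval (y j)

/-- The Legendre coefficient `∫_U Θ(y) L_ν(y) μ₀(dy)` of a function `Θ` on `U`. -/
noncomputable def legendreCoeff {𝕁 : Set ℕ} (Θ : (𝕁 → ℝ) → ℝ) (ν : 𝕁 →₀ ℕ) : ℝ :=
  ∫ y in paramBox 𝕁, Θ y * legendreTensor ν y ∂(prior 𝕁)

/-! ### The radii -/

/-- `|ν_F| = ∑_{j > J₀} ν_j`. -/
def normF {𝕁 : Set ℕ} (J₀ : ℕ) (ν : 𝕁 →₀ ℕ) : ℕ :=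
  ∑ j ∈ ν.support.filter (fun j : 𝕁 => J₀ < (j : ℕ)), ν j

/-- The `ν`-dependent radii: `r_m = K` for `m ≤ J₀` and
`r_m = 1 + a_min ν_m / (4 |ν_F| ‖ψ_m‖)` for `m > J₀`, where `ν_m / |ν_F| = 0` if `|ν_F| = 0`. -/
noncomputable def radius {d : ℕ} {D : Set (EuclideanSpace ℝ (Fin d))} {𝕁 : Set ℕ}
    (ψ : 𝕁 → LInf D) (amin K : ℝ) (J₀ : ℕ) (ν : 𝕁 →₀ ℕ) (m : 𝕁) : ℝ :=
  if (m : ℕ) ≤ J₀ then K else 1 + amin * ν m / (4 * normF J₀ ν * ‖ψ m‖)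

/-- `η_m = r_m + √(1 + r_m²)`. -/
noncomputable def eta {d : ℕ} {D : Set (EuclideanSpace ℝ (Fin d))} {𝕁 : Set ℕ}
    (ψ : 𝕁 → LInf D) (amin K : ℝ) (J₀ : ℕ) (ν : 𝕁 →₀ ℕ) (m : 𝕁) : ℝ :=
  radius ψ amin K J₀ ν m + Real.sqrt (1 + radius ψ amin K J₀ ν m ^ 2)

end BayesElliptic

/-! The density extends holomorphically, one variable at a time, to complex neighbourhoods of
`[-1,1]` whose radii may depend on `ν`, with a bound that does not. Shifting one contour per
variable to a Bernstein ellipse then yields a factor `η_m^{-ν_m}` for each active variable.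

One variable. If `f` is holomorphic on the closed `r`-neighbourhood of `[-1,1]`, its Chebyshev
coefficients can be computed on the ellipse with semi-minor axis `r`, where they decay like
`η^{-|n|}` with `η = r + √(1+r²)`. Since `L_k` is orthogonal to `T_n` for `|n| < k` and has
`L¹(dt/2)` norm at most 1, the `k`-th Legendre coefficient is an integral of `f` over the ellipse
against a kernel of size at most `2η/(η-1) · η^{-k}` (`integral_mul_legendre_eq`,
`norm_legendreKernel_le`). Induction over `supp ν` with Fubini gives the product bound
(`norm_integral_mul_legendreProd_le`).

Holomorphy. The elliptic operator depends affinely on `y`. A point `z` of the product of the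
`ρ_j`-neighbourhoods is within `ρ_j` of some real `y ∈ U` in every coordinate. At `y` the operator
has an inverse of norm at most `1/a_min`, and moving to `z` perturbs it by at most `∑ ρ_j ‖ψ_j‖`. If
this sum is at most `a_min/2`, a Neumann series gives an inverse of norm at most `2/a_min`
(`isUnit_complexOp`). The observations are linear functionals of that inverse and the density is the
exponential of a quadratic polynomial in them, so it is holomorphic and bounded uniformly in `ρ`
(`exists_legendre_bound`).

For these constants to be exact, `H¹₀(D)` is replaced by its space of weak gradients with the `L²`
inner product (`exists_gradient_space`, by Poincaré). Complex scalars enter through the dual `H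
→L[ℝ] ℂ`, on which real operators act by precomposition.

Finally, the prescribed radii satisfy `∑ r_j ‖ψ_j‖ ≤ a_min/2` over `supp ν`
(`sum_radius_mul_norm_le`), and `r_m ≥ K` turns `2η/(η-1)` into `2(1+K)/K`. -/

namespace BayesElliptic

/-! ### Legendre polynomials: orthogonality, normalization, `L¹` bound. -/

section LegendrePolynomials

open Polynomial

theorem eval_iterate_derivative_sq_sub_one_pow {k i : ℕ} (hi : i < k) {x : ℝ} (hx : x ^ 2 = 1) :
    (derivative^[i] ((X ^ 2 - 1 : ℝ[X]) ^ k)).eval x = 0 := by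
  obtain ⟨q, hq⟩ := pow_sub_dvd_iterate_derivative_pow (X ^ 2 - 1 : ℝ[X]) k i
  rw [hq, eval_mul, eval_pow]
  simp [hx, Nat.sub_ne_zero_of_lt hi]

/-- Integration by parts `i` times in Rodrigues' formula: fewer than `k` derivatives leave a factor
`t² - 1`, so no boundary terms appear. -/
theorem integral_iterate_derivative_mul (k : ℕ) : ∀ i ≤ k, ∀ p : ℝ[X],
    ∫ t in (-1 : ℝ)..1, (derivative^[i] ((X ^ 2 - 1 : ℝ[X]) ^ k)).eval t * p.eval t =
      (-1) ^ i * ∫ t in (-1 : ℝ)..1, ((X ^ 2 - 1 : ℝ[X]) ^ k).eval t *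
        (derivative^[i] p).eval t := by
  intro i
  induction i with
  | zero => intro _ p; simp
  | succ i ih =>
    intro hi p
    have h := intervalIntegral.integral_mul_deriv_eq_deriv_mul (a := (-1 : ℝ)) (b := 1)
      (u := fun t => p.eval t) (u' := fun t => (derivative p).eval t)
      (v := fun t => (derivative^[i] ((X ^ 2 - 1 : ℝ[X]) ^ k)).eval t)
      (v' := fun t => (derivative (derivative^[i] ((X ^ 2 - 1 : ℝ[X]) ^ k))).eval t)
      (fun t _ => p.hasDerivAt t) (fun t _ => Polynomial.hasDerivAt _ t)
      (Continuous.intervalIntegrable (by fun_prop) _ _)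
      (Continuous.intervalIntegrable (by fun_prop) _ _)
    rw [eval_iterate_derivative_sq_sub_one_pow hi (by norm_num),
      eval_iterate_derivative_sq_sub_one_pow hi (by norm_num)] at h
    have h2 := ih (by omega) (derivative p)
    simp only [mul_zero, sub_zero, zero_sub] at h
    simp only [Function.iterate_succ_apply', mul_comm _ (eval _ p)] at h ⊢
    rw [h]
    simp only [mul_comm _ (eval _ (derivative p))] at h2 ⊢
    rw [h2, ← Function.iterate_succ_apply, Function.iterate_succ_apply']
    ring

theorem integral_legendre_mul_of_natDegree_lt {k : ℕ} {p : ℝ[X]} (hp : p.natDegree < k) :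
    ∫ t in (-1 : ℝ)..1, (legendre k).eval t * p.eval t = 0 := by
  simp only [legendre, eval_mul, eval_C, mul_assoc]
  rw [intervalIntegral.integral_const_mul, integral_iterate_derivative_mul k k le_rfl,
    iterate_derivative_eq_zero hp]
  simp

/-- Integrating the derivative of `t (1 - t²)^(k+1)`, which vanishes at both ends, gives the
recurrence `(2k+3) I_{k+1} = (2k+2) I_k`. -/
theorem factorial_mul_integral_one_sub_sq_pow (k : ℕ) :
    ((2 * k + 1).factorial : ℝ) * ∫ t in (-1 : ℝ)..1, (1 - t ^ 2) ^ k =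
      2 * 4 ^ k * (k.factorial : ℝ) ^ 2 := by
  induction k with
  | zero => norm_num
  | succ k ih =>
    have h := intervalIntegral.integral_eq_sub_of_hasDerivAt (a := (-1 : ℝ)) (b := 1)
      (f := fun t => t * (1 - t ^ 2) ^ (k + 1))
      (f' := fun t => (2 * k + 3) * (1 - t ^ 2) ^ (k + 1) - (2 * k + 2) * (1 - t ^ 2) ^ k)
      (fun t _ => by
        have := (hasDerivAt_id t).mul ((((hasDerivAt_id t).pow 2).const_sub 1).pow (k + 1))
        convert! this using 1
        simp
        ring)
      (Continuous.intervalIntegrable (by fun_prop) _ _)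
    rw [intervalIntegral.integral_sub (Continuous.intervalIntegrable (by fun_prop) _ _)
      (Continuous.intervalIntegrable (by fun_prop) _ _), intervalIntegral.integral_const_mul,
      intervalIntegral.integral_const_mul] at h
    norm_num at h
    have e : 2 * (k + 1) + 1 = (2 * k + 1 + 1) + 1 := by ring
    rw [e, Nat.factorial_succ (2 * k + 1 + 1), Nat.factorial_succ (2 * k + 1),
      Nat.factorial_succ k]
    push_cast
    have h3 : (2 * k + 3 : ℝ) * ∫ t in (-1 : ℝ)..1, (1 - t ^ 2) ^ (k + 1) =
      (2 * k + 2) * ∫ t in (-1 : ℝ)..1, (1 - t ^ 2) ^ k := by linarith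
    calc _ = (2 * k + 2) * ((2 * k + 1).factorial : ℝ) *
          ((2 * k + 3 : ℝ) * ∫ t in (-1 : ℝ)..1, (1 - t ^ 2) ^ (k + 1)) := by ring
      _ = (2 * k + 2) ^ 2 * (((2 * k + 1).factorial : ℝ) *
          ∫ t in (-1 : ℝ)..1, (1 - t ^ 2) ^ k) := by rw [h3]; ring
      _ = _ := by rw [ih]; ring

theorem iterate_derivative_two_mul_sq_sub_one_pow (k : ℕ) :
    derivative^[2 * k] ((X ^ 2 - 1 : ℝ[X]) ^ k) = C ((2 * k).factorial : ℝ) := by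
  have hm : (X ^ 2 - 1 : ℝ[X]).Monic := by
    simpa using monic_X_pow_sub_C (1 : ℝ) (n := 2) (by norm_num)
  have hd : (X ^ 2 - 1 : ℝ[X]).natDegree = 2 := by
    simpa using natDegree_X_pow_sub_C (n := 2) (r := (1 : ℝ))
  have hd' : ((X ^ 2 - 1 : ℝ[X]) ^ k).natDegree = 2 * k := by
    rw [hm.natDegree_pow, hd, mul_comm]
  have h0 := natDegree_iterate_derivative ((X ^ 2 - 1 : ℝ[X]) ^ k) (2 * k)
  rw [hd', Nat.sub_self, Nat.le_zero] at h0
  rw [eq_C_of_natDegree_eq_zero h0, coeff_iterate_derivative]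
  have hc : ((X ^ 2 - 1 : ℝ[X]) ^ k).coeff (2 * k) = 1 := by
    rw [← hd']; exact (hm.pow k).coeff_natDegree
  simp [hc, Nat.descFactorial_self]

theorem integral_legendre_sq (k : ℕ) :
    ∫ t in (-1 : ℝ)..1, (legendre k).eval t ^ 2 = 2 := by
  have h := integral_iterate_derivative_mul k k le_rfl
    (derivative^[k] ((X ^ 2 - 1 : ℝ[X]) ^ k))
  rw [← Function.iterate_add_apply, ← two_mul, iterate_derivative_two_mul_sq_sub_one_pow] at h
  have h1 : ∫ t in (-1 : ℝ)..1, ((X ^ 2 - 1 : ℝ[X]) ^ k).eval t *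
      (C ((2 * k).factorial : ℝ)).eval t =
      (-1) ^ k * ((2 * k).factorial * ∫ t in (-1 : ℝ)..1, (1 - t ^ 2) ^ k) := by
    rw [← intervalIntegral.integral_const_mul, ← intervalIntegral.integral_const_mul]
    congr 1
    ext t
    simp only [eval_pow, eval_sub, eval_X, eval_one, eval_C]
    rw [show (t ^ 2 - 1 : ℝ) = -1 * (1 - t ^ 2) by ring, mul_pow]
    ring
  rw [h1, ← mul_assoc, ← mul_pow] at h
  norm_num at h
  have h2 := factorial_mul_integral_one_sub_sq_pow k
  rw [Nat.factorial_succ] at h2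
  push_cast at h2
  have hk : (k.factorial : ℝ) ≠ 0 := by positivity
  simp only [legendre, eval_mul, eval_C, mul_pow, div_pow]
  rw [intervalIntegral.integral_const_mul, Real.sq_sqrt (by positivity)]
  simp only [pow_two (eval _ _), h]
  field_simp
  rw [← pow_mul, mul_comm k 2, pow_mul]
  norm_num
  linarith

/-- From `|x| ≤ (1 + x²)/2` and the normalization. -/
theorem integral_abs_legendre_le (k : ℕ) :
    ∫ t in (-1 : ℝ)..1, |(legendre k).eval t| ≤ 2 := by
  have h : ∫ t in (-1 : ℝ)..1, |(legendre k).eval t| ≤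
      ∫ t in (-1 : ℝ)..1, (1 + (legendre k).eval t ^ 2) / 2 := by
    refine intervalIntegral.integral_mono_on (by norm_num)
      (Continuous.intervalIntegrable (by fun_prop) _ _)
      (Continuous.intervalIntegrable (by fun_prop) _ _) fun t _ => ?_
    nlinarith [sq_nonneg (|(legendre k).eval t| - 1), sq_abs ((legendre k).eval t)]
  rw [intervalIntegral.integral_div, intervalIntegral.integral_add
    (Continuous.intervalIntegrable (by fun_prop) _ _)
    (Continuous.intervalIntegrable (by fun_prop) _ _), integral_legendre_sq] at h
  norm_num at h
  linarith

end LegendrePolynomials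

theorem integral_unif {E : Type*} [NormedAddCommGroup E] [NormedSpace ℝ E] (g : ℝ → E) :
    ∫ t, g t ∂unif = (2⁻¹ : ℝ) • ∫ t in (-1 : ℝ)..1, g t := by
  rw [unif, integral_smul_measure, intervalIntegral.integral_of_le (by norm_num),
    integral_Icc_eq_integral_Ioc]
  simp

/-! ### Chebyshev expansion on Bernstein ellipses. -/

section LegendreKernel

/-- The closed `r`-neighbourhood of `[-1,1]` in the complex plane. -/
def stadium (r : ℝ) : Set ℂ := Metric.cthickening r ((fun t : ℝ => (t : ℂ)) '' Set.Icc (-1) 1)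

/-- The Joukowski map, which sends the circle of radius `η` to the Bernstein ellipse. -/
noncomputable def joukowski (w : ℂ) : ℂ := (w + w⁻¹) / 2

/-- The sum of the semi-axes of the Bernstein ellipse with semi-minor axis `r`. -/
noncomputable def semiAxisSum (r : ℝ) : ℝ := r + Real.sqrt (1 + r ^ 2)

theorem mem_stadium {r : ℝ} (hr : 0 ≤ r) {z : ℂ} :
    z ∈ stadium r ↔ ∃ y ∈ Set.Icc (-1 : ℝ) 1, ‖z - y‖ ≤ r := by
  have hc : IsCompact ((fun t : ℝ => (t : ℂ)) '' Set.Icc (-1) 1) :=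
    isCompact_Icc.image Complex.continuous_ofReal
  rw [stadium, hc.cthickening_eq_biUnion_closedBall hr]
  simp [dist_eq_norm]

theorem isClosed_stadium (r : ℝ) : IsClosed (stadium r) := Metric.isClosed_cthickening

theorem ofReal_mem_stadium (r : ℝ) {t : ℝ} (ht : t ∈ Set.Icc (-1 : ℝ) 1) :
    (t : ℂ) ∈ stadium r :=
  Metric.self_subset_cthickening _ (Set.mem_image_of_mem _ ht)

theorem one_add_le_semiAxisSum (r : ℝ) : 1 + r ≤ semiAxisSum r := by
  have : 1 ≤ Real.sqrt (1 + r ^ 2) := Real.one_le_sqrt.2 (by nlinarith [sq_nonneg r])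
  rw [semiAxisSum]; linarith

theorem semiAxisSum_sub_inv {r : ℝ} (hr : 0 ≤ r) :
    (semiAxisSum r - (semiAxisSum r)⁻¹) / 2 = r := by
  have h := one_add_le_semiAxisSum r
  have hs : Real.sqrt (1 + r ^ 2) ^ 2 = 1 + r ^ 2 := Real.sq_sqrt (by positivity)
  have h0 : semiAxisSum r ≠ 0 := by linarith
  field_simp
  rw [semiAxisSum]
  nlinarith

/-- Write `w = ρu` with `|u| = 1` and compare with `Re u ∈ [-1,1]`: the difference is `((ρ-1)u -
(1-ρ⁻¹)ū)/2`, of modulus at most `(ρ - ρ⁻¹)/2`, which is at most `r`. -/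
theorem joukowski_mem_stadium {r : ℝ} (hr : 0 ≤ r) {w : ℂ} (h1 : 1 ≤ ‖w‖)
    (h2 : ‖w‖ ≤ semiAxisSum r) : joukowski w ∈ stadium r := by
  have hw0 : 0 < ‖w‖ := by linarith
  set ρ : ℝ := ‖w‖ with hρ
  set u : ℂ := w / ρ with hu
  have hρ0 : (ρ : ℂ) ≠ 0 := by exact_mod_cast hw0.ne'
  have hwu : w = ρ * u := by rw [hu]; field_simp
  have hu1 : ‖u‖ = 1 := by rw [hu, norm_div, Complex.norm_real, Real.norm_of_nonneg hw0.le, ← hρ,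
    div_self hw0.ne']
  have huinv : u⁻¹ = (starRingEnd ℂ) u := by
    rw [Complex.inv_def, Complex.normSq_eq_norm_sq, hu1]; simp
  refine (mem_stadium hr).2 ⟨u.re, ?_, ?_⟩
  · have := Complex.abs_re_le_norm u
    rw [hu1] at this
    exact abs_le.1 this
  · have hre : (u.re : ℂ) = (u + (starRingEnd ℂ) u) / 2 := by
      rw [Complex.add_conj]; push_cast; ring
    have e : joukowski w - u.re =
        (((ρ - 1 : ℝ) : ℂ) * u - ((1 - ρ⁻¹ : ℝ) : ℂ) * (starRingEnd ℂ) u) / 2 := by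
      rw [hre, joukowski, hwu, mul_inv, huinv]; push_cast; ring
    have hρ1 : ρ⁻¹ ≤ 1 := inv_le_one_of_one_le₀ h1
    have hinv : (semiAxisSum r)⁻¹ ≤ ρ⁻¹ := inv_anti₀ hw0 h2
    rw [e, norm_div]
    calc _ ≤ (‖((ρ - 1 : ℝ) : ℂ) * u‖ + ‖((1 - ρ⁻¹ : ℝ) : ℂ) * (starRingEnd ℂ) u‖) / ‖(2 : ℂ)‖ := by
          gcongr; exact norm_sub_le _ _
      _ = ((ρ - 1) + (1 - ρ⁻¹)) / 2 := by
          rw [norm_mul, norm_mul, RCLike.norm_conj, hu1, Complex.norm_real, Complex.norm_real,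
            Real.norm_of_nonneg (by linarith), Real.norm_of_nonneg (by linarith)]
          simp
      _ ≤ (semiAxisSum r - (semiAxisSum r)⁻¹) / 2 := by linarith
      _ = r := semiAxisSum_sub_inv hr

theorem norm_circleMap_zero' {η : ℝ} (hη : 0 ≤ η) (φ : ℝ) : ‖circleMap 0 η φ‖ = η := by
  simp [abs_of_nonneg hη]

/-- The Chebyshev coefficient `a_{|n|} / 2` of `f`, computed on the Bernstein ellipse. -/
noncomputable def chebyshevCoeff (f : ℂ → ℂ) (η : ℝ) (n : ℤ) : ℂ :=
  (2 * Real.pi : ℝ)⁻¹ • ∫ φ in (0 : ℝ)..2 * Real.pi,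
    f (joukowski (circleMap 0 η φ)) * ((circleMap 0 η φ)⁻¹) ^ n.natAbs

theorem circleIntegral_inv_smul {R : ℝ} (hR : R ≠ 0) (g : ℂ → ℂ) :
    (∮ z in C(0, R), (z - 0)⁻¹ • g z) =
      Complex.I * ∫ φ in (0 : ℝ)..2 * Real.pi, g (circleMap 0 R φ) := by
  rw [circleIntegral, ← intervalIntegral.integral_const_mul]
  congr 1
  ext φ
  have : circleMap 0 R φ ≠ 0 := circleMap_ne_center hR
  simp only [deriv_circleMap, sub_zero, smul_eq_mul]
  field_simp

variable {r : ℝ} {f : ℂ → ℂ}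

theorem continuousOn_comp_joukowski (hr : 0 ≤ r) (hf : DifferentiableOn ℂ f (stadium r)) :
    ContinuousOn (fun w => f (joukowski w))
      (Metric.closedBall 0 (semiAxisSum r) \ Metric.ball 0 1) := by
  refine hf.continuousOn.comp ?_ ?_
  · intro w hw
    have : w ≠ 0 := by rintro rfl; simp at hw
    unfold joukowski
    exact ((continuousAt_id.add (continuousAt_inv₀ this)).div_const 2).continuousWithinAt
  · intro w hw
    simp only [Set.mem_sdiff, mem_closedBall_zero_iff, mem_ball_zero_iff, not_lt] at hw
    exact joukowski_mem_stadium hr hw.2 hw.1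

theorem continuous_comp_joukowski_circleMap (hr : 0 ≤ r)
    (hf : DifferentiableOn ℂ f (stadium r)) :
    Continuous fun φ : ℝ => f (joukowski (circleMap 0 (semiAxisSum r) φ)) := by
  have h1 := one_add_le_semiAxisSum r
  refine (continuousOn_comp_joukowski hr hf).comp_continuous (continuous_circleMap _ _)
    fun φ => ?_
  have := norm_circleMap_zero' (η := semiAxisSum r) (by linarith) φ
  simp only [Set.mem_sdiff, mem_closedBall_zero_iff, mem_ball_zero_iff, not_lt, this]
  constructor <;> linarith

theorem differentiableAt_joukowski {w : ℂ} (hw : w ≠ 0) :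
    DifferentiableAt ℂ joukowski w := by
  unfold joukowski
  exact (differentiableAt_id.add (differentiableAt_inv hw)).div_const 2

/-- Cauchy's theorem on the annulus `1 ≤ |w| ≤ η`, which the Joukowski map sends into the domain of
`f`. -/
theorem chebyshevCoeff_eq (hr : 0 ≤ r) (hf : DifferentiableOn ℂ f (stadium r)) (n : ℤ) :
    chebyshevCoeff f (semiAxisSum r) n = chebyshevCoeff f 1 n := by
  have h1 := one_add_le_semiAxisSum r
  have hne : ∀ w ∈ Metric.closedBall (0 : ℂ) (semiAxisSum r) \ Metric.ball 0 1, w ≠ 0 := by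
    rintro w hw rfl; simp at hw
  have key := Complex.circleIntegral_sub_center_inv_smul_eq_of_differentiable_on_annulus_off_countable
    (c := 0) (r := 1) (R := semiAxisSum r) one_pos (by linarith)
    (f := fun w => f (joukowski w) * w⁻¹ ^ n.natAbs) (s := ∅) Set.countable_empty
    ((continuousOn_comp_joukowski hr hf).mul
      ((continuousOn_inv₀.mono fun w hw => hne w hw).pow _)) ?_
  · rw [circleIntegral_inv_smul (by linarith), circleIntegral_inv_smul one_ne_zero] at key
    rw [chebyshevCoeff, chebyshevCoeff, mul_left_cancel₀ Complex.I_ne_zero key]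
  · intro w hw
    simp only [Set.sdiff_empty, Set.mem_sdiff, mem_ball_zero_iff, mem_closedBall_zero_iff,
      not_le] at hw
    have hw0 : w ≠ 0 := by rintro rfl; simp at hw; linarith
    have hop : ∀ᶠ z in nhds w, joukowski z ∈ stadium r := by
      have h2 : ∀ᶠ z : ℂ in nhds w, 1 < ‖z‖ :=
        continuous_norm.continuousAt.eventually (lt_mem_nhds hw.2)
      have h3 : ∀ᶠ z : ℂ in nhds w, ‖z‖ < semiAxisSum r :=
        continuous_norm.continuousAt.eventually (gt_mem_nhds hw.1)
      filter_upwards [h2, h3] with z h2 h3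
      exact joukowski_mem_stadium hr h2.le h3.le
    have hcomp : DifferentiableAt ℂ (fun z => f (joukowski z)) w := by
      have hd : DifferentiableWithinAt ℂ (fun z => f (joukowski z)) (joukowski ⁻¹' stadium r) w :=
        (hf _ hop.self_of_nhds).comp w
          (differentiableAt_joukowski hw0).differentiableWithinAt
          (Set.mapsTo_preimage _ _)
      exact hd.differentiableAt hop
    exact hcomp.mul ((differentiableAt_inv hw0).pow _)

theorem norm_chebyshevCoeff_le {M : ℝ}
    (hM : ∀ φ : ℝ, ‖f (joukowski (circleMap 0 (semiAxisSum r) φ))‖ ≤ M) (hr : 0 ≤ r) (n : ℤ) :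
    ‖chebyshevCoeff f (semiAxisSum r) n‖ ≤ M * (semiAxisSum r)⁻¹ ^ n.natAbs := by
  have h1 := one_add_le_semiAxisSum r
  have := intervalIntegral.norm_integral_le_of_norm_le_const (a := 0) (b := 2 * Real.pi)
    (f := fun φ => f (joukowski (circleMap 0 (semiAxisSum r) φ)) *
      ((circleMap 0 (semiAxisSum r) φ)⁻¹) ^ n.natAbs) (C := M * (semiAxisSum r)⁻¹ ^ n.natAbs) ?_
  · rw [chebyshevCoeff, norm_smul]
    rw [sub_zero, abs_of_pos Real.two_pi_pos] at this
    calc _ ≤ ‖(2 * Real.pi)⁻¹‖ * (M * (semiAxisSum r)⁻¹ ^ n.natAbs * (2 * Real.pi)) := by gcongr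
      _ = _ := by
        rw [Real.norm_of_nonneg (by positivity)]
        field_simp
  · intro φ _
    rw [norm_mul, norm_pow, norm_inv, norm_circleMap_zero' (by linarith)]
    have : 0 ≤ (semiAxisSum r)⁻¹ := by
      apply inv_nonneg.2; linarith
    gcongr
    exact hM φ

theorem exists_bound_comp_joukowski (hr : 0 ≤ r)
    (hf : DifferentiableOn ℂ f (stadium r)) :
    ∃ M, ∀ φ : ℝ, ‖f (joukowski (circleMap 0 (semiAxisSum r) φ))‖ ≤ M := by
  obtain ⟨M, hM⟩ := (isCompact_Icc (a := (0 : ℝ)) (b := 2 * Real.pi)).exists_bound_of_continuousOn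
    (continuous_comp_joukowski_circleMap hr hf).continuousOn
  refine ⟨M, fun φ => ?_⟩
  obtain ⟨y, hy, e⟩ := (periodic_circleMap 0 (semiAxisSum r)).exists_mem_Ico₀ Real.two_pi_pos φ
  rw [e]
  exact hM y (Set.Ico_subset_Icc_self hy)

theorem summable_pow_natAbs {q : ℝ} (hq0 : 0 ≤ q) (hq1 : q < 1) :
    Summable fun n : ℤ => q ^ n.natAbs := by
  have h := summable_geometric_of_lt_one hq0 hq1
  refine Summable.of_nat_of_neg (by simpa using h) (by simpa using h)

open Polynomial in
-- This is the Fourier series of the even function `θ ↦ f(cos θ)`. Its coefficients are the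
-- Chebyshev ones on the unit circle; moved to the ellipse they decay geometrically, so the series
-- converges pointwise.
theorem hasSum_chebyshevCoeff (hr : 0 < r) (hf : DifferentiableOn ℂ f (stadium r)) {t : ℝ}
    (ht : t ∈ Set.Icc (-1 : ℝ) 1) :
    HasSum (fun n : ℤ => chebyshevCoeff f (semiAxisSum r) n *
      (((Chebyshev.T ℝ n).eval t : ℝ) : ℂ)) (f t) := by
  have h1 := one_add_le_semiAxisSum r
  have : Fact (0 < 2 * Real.pi) := ⟨Real.two_pi_pos⟩
  let h : C(AddCircle (2 * Real.pi), ℂ) :=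
    ⟨fun x => f (((AddCircle.toCircle x : ℂ).re : ℝ) : ℂ), by
      refine hf.continuousOn.comp_continuous
        (Complex.continuous_ofReal.comp (Complex.continuous_re.comp
          (continuous_subtype_val.comp AddCircle.continuous_toCircle))) fun x => ?_
      refine ofReal_mem_stadium r (abs_le.1 ?_)
      have := Complex.abs_re_le_norm (AddCircle.toCircle x : ℂ)
      rwa [Circle.norm_coe] at this⟩
  have hcoe : ∀ x : ℝ, h (x : AddCircle (2 * Real.pi)) = f (Real.cos x : ℝ) := by
    intro x
    change f (((AddCircle.toCircle (x : AddCircle (2 * Real.pi)) : ℂ).re : ℝ) : ℂ) = _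
    rw [AddCircle.toCircle_apply_mk, Circle.coe_exp]
    congr 2
    rw [Complex.exp_ofReal_mul_I_re]
    congr 1
    field_simp
  have hneg : ∀ x, h (-x) = h x := by
    intro x
    change f (((AddCircle.toCircle (-x) : ℂ).re : ℝ) : ℂ) =
      f (((AddCircle.toCircle x : ℂ).re : ℝ) : ℂ)
    rw [AddCircle.toCircle_neg, Circle.coe_inv_eq_conj, Complex.conj_re]
  have hc0 : ∀ n : ℕ, fourierCoeff h n = chebyshevCoeff f 1 n := by
    intro n
    rw [fourierCoeff_eq_intervalIntegral _ _ 0, chebyshevCoeff, zero_add, one_div]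
    congr 1
    refine intervalIntegral.integral_congr fun φ _ => ?_
    have e1 : circleMap 0 1 φ = Complex.exp (φ * Complex.I) := by simp [circleMap]
    have e2 : joukowski (circleMap 0 1 φ) = ((Real.cos φ : ℝ) : ℂ) := by
      rw [joukowski, e1, ← Complex.exp_neg, Complex.ofReal_cos, Complex.cos]
      ring_nf
    simp only [hcoe, e2, smul_eq_mul, fourier_coe_apply, Int.natAbs_natCast]
    rw [mul_comm, e1, ← Complex.exp_neg, ← Complex.exp_nat_mul]
    congr 2
    have : (Real.pi : ℂ) ≠ 0 := by exact_mod_cast Real.pi_ne_zero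
    push_cast
    field_simp
  have hcneg : ∀ n : ℤ, fourierCoeff h (-n) = fourierCoeff h n := by
    intro n
    rw [fourierCoeff, fourierCoeff, ← integral_neg_eq_self]
    congr 1
    ext x
    rw [hneg]
    congr 1
    simp [fourier_apply]
  have hc : ∀ n : ℤ, fourierCoeff h n = chebyshevCoeff f (semiAxisSum r) n := by
    intro n
    rw [chebyshevCoeff_eq hr.le hf]
    rcases Int.natAbs_eq n with e | e
    · rw [e, hc0]
    · rw [e, hcneg, hc0]
      simp [chebyshevCoeff]
  obtain ⟨M, hM⟩ := exists_bound_comp_joukowski hr.le hf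
  have hsum : Summable (fourierCoeff h) := by
    refine Summable.of_norm_bounded
      ((summable_pow_natAbs (q := (semiAxisSum r)⁻¹) ?_ ?_).mul_left M) fun n => ?_
    · apply inv_nonneg.2; linarith
    · apply inv_lt_one_of_one_lt₀; linarith
    · rw [hc]; exact norm_chebyshevCoeff_le hM hr.le n
  -- Averaging the series at `θ` and `-θ`, `θ = arccos t`, turns exponentials into `cos nθ =
  -- T_n(t)`.
  have s1 := has_pointwise_sum_fourier_series_of_summable hsum (Real.arccos t : ℝ)
  have s2 := has_pointwise_sum_fourier_series_of_summable hsum (-Real.arccos t : ℝ)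
  rw [hcoe, Real.cos_arccos ht.1 ht.2] at s1
  rw [hcoe, Real.cos_neg, Real.cos_arccos ht.1 ht.2] at s2
  convert! (s1.add s2).mul_left (1 / 2) using 1
  · ext n
    have hT : (Chebyshev.T ℝ n).eval t = Real.cos (n * Real.arccos t) := by
      rw [← Chebyshev.T_real_cos, Real.cos_arccos ht.1 ht.2]
    rw [hT, ← hc, Complex.ofReal_cos, Complex.cos]
    simp only [smul_eq_mul, fourier_coe_apply]
    have hpi : (Real.pi : ℂ) ≠ 0 := by exact_mod_cast Real.pi_ne_zero
    have e1 : 2 * (Real.pi : ℂ) * Complex.I * n * (Real.arccos t : ℝ) / ((2 * Real.pi : ℝ) : ℂ) =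
      ((n * Real.arccos t : ℝ) : ℂ) * Complex.I := by push_cast; field_simp
    have e2 : 2 * (Real.pi : ℂ) * Complex.I * n * ((-Real.arccos t : ℝ) : ℂ) /
        ((2 * Real.pi : ℝ) : ℂ) = -((n * Real.arccos t : ℝ) : ℂ) * Complex.I := by
      push_cast; field_simp
    rw [e1, e2]
    push_cast
    ring
  · ring

end LegendreKernel
-- The Legendre kernel on the ellipse and its size.
section LegendreKernelBound

open Polynomial

theorem hasSum_tail_pow {q : ℝ} (hq0 : 0 ≤ q) (hq1 : q < 1) (k : ℕ) :
    HasSum (fun n : ℕ => if k ≤ n then q ^ n else 0) (q ^ k * (1 - q)⁻¹) := by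
  have h := (hasSum_geometric_of_lt_one hq0 hq1).mul_left (q ^ k)
  have h0 : ∑ i ∈ Finset.range k, (if k ≤ i then q ^ i else 0) = 0 :=
    Finset.sum_eq_zero fun i hi => if_neg (not_le.2 (Finset.mem_range.1 hi))
  rw [← hasSum_nat_add_iff' k, h0, sub_zero]
  convert! h using 2 with n
  rw [if_pos (by omega), pow_add, mul_comm]

theorem hasSum_tail_pow_natAbs {q : ℝ} (hq0 : 0 ≤ q) (hq1 : q < 1) {k : ℕ} (hk : 1 ≤ k) :
    HasSum (fun n : ℤ => if k ≤ n.natAbs then q ^ n.natAbs else 0)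
      (2 * (q ^ k * (1 - q)⁻¹)) := by
  have h := hasSum_tail_pow hq0 hq1 k
  rw [two_mul]
  -- The negative half lacks the index `0`, whose term vanishes because `k ≥ 1`; hence both halves
  -- have the same sum.
  refine HasSum.of_nat_of_neg_add_one (by simpa using h) ?_
  have h2 := h
  rw [← hasSum_nat_add_iff' 1] at h2
  have e : ∀ n : ℕ, (-((n : ℤ) + 1)).natAbs = n + 1 := fun n => by omega
  simp only [e]
  simpa [show ¬ k ≤ 0 by omega] using h2

/-- The inner product of `L_k` with the Chebyshev polynomial `T_n`. -/
noncomputable def legendreChebyshev (k : ℕ) (n : ℤ) : ℝ :=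
  2⁻¹ * ∫ t in (-1 : ℝ)..1, (legendre k).eval t * (Chebyshev.T ℝ n).eval t

theorem legendreChebyshev_eq_zero {k : ℕ} {n : ℤ} (h : n.natAbs < k) :
    legendreChebyshev k n = 0 := by
  rw [legendreChebyshev, integral_legendre_mul_of_natDegree_lt, mul_zero]
  rwa [Chebyshev.natDegree_T]

theorem abs_legendreChebyshev_le (k : ℕ) (n : ℤ) : |legendreChebyshev k n| ≤ 1 := by
  have h : |∫ t in (-1 : ℝ)..1, (legendre k).eval t * (Chebyshev.T ℝ n).eval t| ≤
      ∫ t in (-1 : ℝ)..1, |(legendre k).eval t| := by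
    rw [← Real.norm_eq_abs]
    refine intervalIntegral.norm_integral_le_of_norm_le (by norm_num)
      (Filter.Eventually.of_forall fun t ht => ?_)
      (Continuous.intervalIntegrable (by fun_prop) _ _)
    rw [norm_mul, Real.norm_eq_abs, Real.norm_eq_abs]
    refine mul_le_of_le_one_right (abs_nonneg _) (Chebyshev.abs_eval_T_real_le_one n ?_)
    exact abs_le.2 ⟨ht.1.le, ht.2⟩
  rw [legendreChebyshev, abs_mul, abs_of_pos (by norm_num : (0 : ℝ) < 2⁻¹)]
  linarith [integral_abs_legendre_le k]

/-- The kernel which represents the `k`-th Legendre coefficient as an integral over the boundary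
of the Bernstein ellipse. -/
noncomputable def legendreKernel (k : ℕ) (η φ : ℝ) : ℂ :=
  ∑' n : ℤ, ((circleMap 0 η φ)⁻¹) ^ n.natAbs * legendreChebyshev k n

theorem norm_legendreKernel_term_le (k : ℕ) {η : ℝ} (hη : 1 < η) (n : ℤ) (φ : ℝ) :
    ‖((circleMap 0 η φ)⁻¹) ^ n.natAbs * (legendreChebyshev k n : ℂ)‖ ≤
      if k ≤ n.natAbs then η⁻¹ ^ n.natAbs else 0 := by
  split_ifs with h
  · rw [norm_mul, norm_pow, norm_inv, norm_circleMap_zero' (by linarith), Complex.norm_real,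
      Real.norm_eq_abs]
    exact mul_le_of_le_one_right (pow_nonneg (inv_nonneg.2 (by linarith)) _)
      (abs_legendreChebyshev_le k n)
  · rw [legendreChebyshev_eq_zero (not_le.1 h)]
    simp

theorem hasSum_kernel_bound {k : ℕ} (hk : 1 ≤ k) {η : ℝ} (hη : 1 < η) :
    HasSum (fun n : ℤ => if k ≤ n.natAbs then η⁻¹ ^ n.natAbs else 0)
      (2 * (η / (η - 1)) * (η ^ k)⁻¹) := by
  convert! hasSum_tail_pow_natAbs (q := η⁻¹) (inv_nonneg.2 (by linarith))
    (inv_lt_one_of_one_lt₀ hη) hk using 1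
  have h1 : η - 1 ≠ 0 := by linarith
  have h2 : η ≠ 0 := by linarith
  have h3 : 1 - η⁻¹ ≠ 0 := by
    rw [sub_ne_zero]; exact (inv_lt_one_of_one_lt₀ hη).ne'
  rw [inv_pow]
  field_simp

theorem norm_legendreKernel_le {k : ℕ} (hk : 1 ≤ k) {η : ℝ} (hη : 1 < η) (φ : ℝ) :
    ‖legendreKernel k η φ‖ ≤ 2 * (η / (η - 1)) * (η ^ k)⁻¹ :=
  tsum_of_norm_bounded (hasSum_kernel_bound hk hη) fun n => norm_legendreKernel_term_le k hη n φ

theorem continuous_circleMap_inv_pow {η : ℝ} (hη : 1 < η) (m : ℕ) :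
    Continuous fun φ : ℝ => ((circleMap 0 η φ)⁻¹) ^ m :=
  ((continuous_circleMap 0 η).inv₀ fun φ => circleMap_ne_center (by linarith)).pow m

theorem continuous_legendreKernel {k : ℕ} (hk : 1 ≤ k) {η : ℝ} (hη : 1 < η) :
    Continuous (legendreKernel k η) :=
  continuous_tsum (fun _ => (continuous_circleMap_inv_pow hη _).mul continuous_const)
    (hasSum_kernel_bound hk hη).summable fun n φ => norm_legendreKernel_term_le k hη n φ

theorem hasSum_integral_legendre {r : ℝ} {f : ℂ → ℂ} (hr : 0 < r)
    (hf : DifferentiableOn ℂ f (stadium r)) (k : ℕ) :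
    HasSum (fun n : ℤ => chebyshevCoeff f (semiAxisSum r) n * legendreChebyshev k n)
      (∫ t, f t * ((legendre k).eval t : ℝ) ∂unif) := by
  have h1 := one_add_le_semiAxisSum r
  obtain ⟨M, hM⟩ := exists_bound_comp_joukowski hr.le hf
  obtain ⟨B, hB⟩ := (isCompact_Icc (a := (-1 : ℝ)) (b := 1)).exists_bound_of_continuousOn
    (f := fun t => (legendre k).eval t) (by fun_prop)
  have hM0 : 0 ≤ M := (norm_nonneg _).trans (hM 0)
  have hB0 : 0 ≤ B := (norm_nonneg _).trans (hB 0 (by norm_num))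
  have hq : 0 ≤ (semiAxisSum r)⁻¹ := inv_nonneg.2 (by linarith)
  have hs := summable_pow_natAbs hq (inv_lt_one_of_one_lt₀ (by linarith))
  rw [integral_unif]
  have key := intervalIntegral.hasSum_integral_of_dominated_convergence (a := -1) (b := 1)
    (μ := volume)
    (F := fun (n : ℤ) (t : ℝ) => chebyshevCoeff f (semiAxisSum r) n *
      (((Chebyshev.T ℝ n).eval t : ℝ) : ℂ) * ((legendre k).eval t : ℝ))
    (f := fun t => f t * ((legendre k).eval t : ℝ))
    (fun n _ => M * (semiAxisSum r)⁻¹ ^ n.natAbs * B)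
    (fun n => (Continuous.aestronglyMeasurable (by fun_prop))) ?_ ?_ ?_ ?_
  · have := key.const_smul (2⁻¹ : ℝ)
    refine this.congr_fun ?_
    intro n
    have e : ∀ t : ℝ, chebyshevCoeff f (semiAxisSum r) n *
        (((Chebyshev.T ℝ n).eval t : ℝ) : ℂ) * ((legendre k).eval t : ℝ) =
        chebyshevCoeff f (semiAxisSum r) n *
          (((legendre k).eval t * (Chebyshev.T ℝ n).eval t : ℝ) : ℂ) := by
      intro t; rw [Complex.ofReal_mul]; ring
    simp only [e]
    rw [intervalIntegral.integral_const_mul, intervalIntegral.integral_ofReal,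
      legendreChebyshev, Complex.real_smul, Complex.ofReal_mul]
    ring
  · intro n
    filter_upwards with t ht
    rw [Set.uIoc_of_le (by norm_num)] at ht
    have hT := Chebyshev.abs_eval_T_real_le_one n (abs_le.2 ⟨ht.1.le, ht.2⟩)
    have h3 := norm_chebyshevCoeff_le hM hr.le n
    rw [norm_mul, norm_mul, Complex.norm_real, Complex.norm_real, Real.norm_eq_abs]
    have h4 := hB t ⟨ht.1.le, ht.2⟩
    calc _ ≤ M * (semiAxisSum r)⁻¹ ^ n.natAbs * 1 * B := by gcongr
      _ = _ := by ring
  · filter_upwards with t _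
    exact (hs.mul_left M).mul_right B
  · exact intervalIntegrable_const
  · filter_upwards with t ht
    rw [Set.uIoc_of_le (by norm_num)] at ht
    exact (hasSum_chebyshevCoeff hr hf ⟨ht.1.le, ht.2⟩).mul_right _

/-- The Legendre coefficient of a function holomorphic near the Bernstein ellipse as an integral
over the boundary of the ellipse. -/
theorem integral_mul_legendre_eq {r : ℝ} {f : ℂ → ℂ} (hr : 0 < r)
    (hf : DifferentiableOn ℂ f (stadium r)) {k : ℕ} (hk : 1 ≤ k) :
    ∫ t, f t * ((legendre k).eval t : ℝ) ∂unif = (2 * Real.pi : ℝ)⁻¹ •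
      ∫ φ in (0 : ℝ)..2 * Real.pi, f (joukowski (circleMap 0 (semiAxisSum r) φ)) *
        legendreKernel k (semiAxisSum r) φ := by
  have h1 := one_add_le_semiAxisSum r
  have hη : 1 < semiAxisSum r := by linarith
  obtain ⟨M, hM⟩ := exists_bound_comp_joukowski hr.le hf
  have hM0 : 0 ≤ M := (norm_nonneg _).trans (hM 0)
  have hb := hasSum_kernel_bound hk hη
  have key := intervalIntegral.hasSum_integral_of_dominated_convergence (a := 0)
    (b := 2 * Real.pi) (μ := volume)
    (F := fun (n : ℤ) (φ : ℝ) => f (joukowski (circleMap 0 (semiAxisSum r) φ)) *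
      (((circleMap 0 (semiAxisSum r) φ)⁻¹) ^ n.natAbs * (legendreChebyshev k n : ℂ)))
    (f := fun φ => f (joukowski (circleMap 0 (semiAxisSum r) φ)) *
        legendreKernel k (semiAxisSum r) φ)
    (fun n _ => M * if k ≤ n.natAbs then (semiAxisSum r)⁻¹ ^ n.natAbs else 0) ?_ ?_ ?_ ?_ ?_
  -- Both sides sum the same series: Chebyshev coefficient times `⟨L_k, T_n⟩`, the coefficient being
  -- an integral over the ellipse.
  · refine (hasSum_integral_legendre hr hf k).unique ((key.const_smul _).congr_fun ?_)
    intro n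
    rw [chebyshevCoeff, smul_mul_assoc, ← intervalIntegral.integral_mul_const]
    simp only [mul_assoc]
  · intro n
    exact ((continuous_comp_joukowski_circleMap hr.le hf).mul
      ((continuous_circleMap_inv_pow hη _).mul continuous_const)).aestronglyMeasurable
  · intro n
    filter_upwards with φ _
    rw [norm_mul]
    exact mul_le_mul (hM φ) (norm_legendreKernel_term_le k hη n φ) (norm_nonneg _) hM0
  · filter_upwards with φ _
    exact hb.summable.mul_left M
  · exact intervalIntegrable_const
  · filter_upwards with φ _
    refine HasSum.mul_left _ (Summable.hasSum ?_)
    exact Summable.of_norm_bounded hb.summable fun n => norm_legendreKernel_term_le k hη n φ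

end LegendreKernelBound
-- Product measure and iteration over the variables.
section ProductMeasure

variable {𝕁 : Set ℕ}

instance : IsProbabilityMeasure (prior 𝕁) := by unfold prior; infer_instance

theorem ae_unif_mem : ∀ᵐ t ∂unif, t ∈ Set.Icc (-1 : ℝ) 1 := by
  rw [unif]
  exact Measure.ae_smul_measure (ae_restrict_mem measurableSet_Icc) _

theorem ae_prior_mem : ∀ᵐ y ∂prior 𝕁, y ∈ paramBox 𝕁 := by
  simp only [paramBox, Set.mem_univ_pi]
  rw [ae_all_iff]
  intro j
  exact (measurePreserving_eval_infinitePi (fun _ : 𝕁 => unif) j).quasiMeasurePreserving.ae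
    ae_unif_mem

theorem measurable_update_prod (m : 𝕁) :
    Measurable fun p : (𝕁 → ℝ) × ℝ => Function.update p.1 m p.2 := by
  refine measurable_pi_lambda _ fun j => ?_
  by_cases h : j = m
  · subst h; simpa using measurable_snd
  · simp only [Function.update_of_ne h]
    exact (measurable_pi_apply j).comp measurable_fst

/-- Resampling one coordinate independently preserves the product measure. This singles out a
variable without splitting the index set. -/
theorem measurePreserving_update (m : 𝕁) :
    MeasurePreserving (fun p : (𝕁 → ℝ) × ℝ => Function.update p.1 m p.2)
      ((prior 𝕁).prod unif) (prior 𝕁) := by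
  refine ⟨measurable_update_prod m, ?_⟩
  conv_rhs => rw [prior]
  refine Measure.eq_infinitePi _ fun s t ht => ?_
  rw [Measure.map_apply (measurable_update_prod m)
    (MeasurableSet.pi s.countable_toSet fun j _ => ht j)]
  by_cases hm : m ∈ s
  · have e : (fun p : (𝕁 → ℝ) × ℝ => Function.update p.1 m p.2) ⁻¹' (s : Set 𝕁).pi t =
        ((s.erase m : Finset 𝕁) : Set 𝕁).pi t ×ˢ t m := by
      ext p
      simp only [Set.mem_preimage, Set.mem_pi, Finset.mem_coe, Set.mem_prod, Finset.mem_erase]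
      constructor
      · intro h
        refine ⟨fun j hj => ?_, by simpa using h m hm⟩
        simpa [Function.update_of_ne hj.1] using h j hj.2
      · rintro ⟨h1, h2⟩ j hj
        by_cases hjm : j = m
        · subst hjm; simpa using h2
        · simpa [Function.update_of_ne hjm] using h1 j ⟨hjm, hj⟩
    rw [e, Measure.prod_prod, prior, Measure.infinitePi_pi _ (fun j _ => ht j),
      Finset.prod_erase_mul _ _ hm]
  · have e : (fun p : (𝕁 → ℝ) × ℝ => Function.update p.1 m p.2) ⁻¹' (s : Set 𝕁).pi t =
        (s : Set 𝕁).pi t ×ˢ Set.univ := by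
      ext p
      simp only [Set.mem_preimage, Set.mem_pi, Finset.mem_coe, Set.mem_prod, Set.mem_univ,
        and_true]
      refine forall₂_congr fun j hj => ?_
      rw [Function.update_of_ne (by rintro rfl; exact hm hj)]
    rw [e, Measure.prod_prod, measure_univ, mul_one, prior,
      Measure.infinitePi_pi _ (fun j _ => ht j)]

theorem integral_prior_eq_update {F : (𝕁 → ℝ) → ℂ} (hF : Integrable F (prior 𝕁)) (m : 𝕁) :
    ∫ y, F y ∂prior 𝕁 = ∫ y, ∫ t, F (Function.update y m t) ∂unif ∂prior 𝕁 := by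
  have h := measurePreserving_update m
  have hF' : AEStronglyMeasurable F (Measure.map
      (fun p : (𝕁 → ℝ) × ℝ => Function.update p.1 m p.2) ((prior 𝕁).prod unif)) := by
    rw [h.map_eq]; exact hF.aestronglyMeasurable
  conv_lhs => rw [← h.map_eq, integral_map h.measurable.aemeasurable hF']
  exact integral_prod _ ((integrable_map_measure hF' h.measurable.aemeasurable).1
    (by rwa [h.map_eq]))

/-- The product of the stadia of opening `ρ j`. -/
def polyStadium (ρ : 𝕁 → ℝ) : Set (𝕁 → ℂ) := Set.univ.pi fun j => stadium (ρ j)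

theorem isClosed_polyStadium (ρ : 𝕁 → ℝ) : IsClosed (polyStadium ρ) :=
  isClosed_set_pi fun _ _ => isClosed_stadium _

theorem ofReal_mem_polyStadium (ρ : 𝕁 → ℝ) {y : 𝕁 → ℝ} (hy : y ∈ paramBox 𝕁) :
    (fun j => (y j : ℂ)) ∈ polyStadium ρ :=
  fun j _ => ofReal_mem_stadium _ (hy j trivial)

theorem update_mem_polyStadium {ρ : 𝕁 → ℝ} {z : 𝕁 → ℂ} (hz : z ∈ polyStadium ρ) {m : 𝕁} {ζ : ℂ}
    (hζ : ζ ∈ stadium (ρ m)) : Function.update z m ζ ∈ polyStadium ρ := by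
  intro j _
  by_cases h : j = m
  · subst h; simpa using hζ
  · simpa [Function.update_of_ne h] using hz j trivial

/-- The tensorized Legendre polynomial over a finite set of variables. -/
noncomputable def legendreProd (ν : 𝕁 → ℕ) (T : Finset 𝕁) (y : 𝕁 → ℝ) : ℝ :=
  ∏ j ∈ T, (legendre (ν j)).eval (y j)

theorem continuous_legendreProd (ν : 𝕁 → ℕ) (T : Finset 𝕁) : Continuous (legendreProd ν T) := by
  unfold legendreProd
  exact continuous_finsetProd _ fun j _ =>
    (legendre (ν j)).continuous.comp (continuous_apply j)

theorem exists_legendreProd_bound (ν : 𝕁 → ℕ) (T : Finset 𝕁) :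
    ∃ B, 0 ≤ B ∧ ∀ y ∈ paramBox 𝕁, |legendreProd ν T y| ≤ B := by
  have hc : IsCompact (paramBox 𝕁) := isCompact_univ_pi fun _ => isCompact_Icc
  obtain ⟨B, hB⟩ := hc.exists_bound_of_continuousOn (continuous_legendreProd ν T).continuousOn
  exact ⟨|B|, abs_nonneg _, fun y hy => (hB y hy).trans (le_abs_self _)⟩

theorem integrable_mul_legendreProd {ρ : 𝕁 → ℝ} {G : (𝕁 → ℂ) → ℂ} (hG : Measurable G) {M : ℝ}
    (hM : ∀ z ∈ polyStadium ρ, ‖G z‖ ≤ M) (ν : 𝕁 → ℕ) (T : Finset 𝕁) :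
    Integrable (fun y : 𝕁 → ℝ => G (fun j => y j) * (legendreProd ν T y : ℂ)) (prior 𝕁) := by
  obtain ⟨B, hB0, hB⟩ := exists_legendreProd_bound ν T
  refine Integrable.of_bound (C := M * B) ?_ ?_
  · refine Measurable.aestronglyMeasurable (Measurable.mul (hG.comp ?_) ?_)
    · exact measurable_pi_lambda _ fun j => Complex.measurable_ofReal.comp (measurable_pi_apply j)
    · exact Complex.measurable_ofReal.comp (continuous_legendreProd ν T).measurable
  · filter_upwards [ae_prior_mem] with y hy
    have h1 := hM _ (ofReal_mem_polyStadium ρ hy)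
    rw [norm_mul, Complex.norm_real, Real.norm_eq_abs]
    exact mul_le_mul h1 (hB y hy) (abs_nonneg _) ((norm_nonneg _).trans h1)

theorem legendreProd_insert_update (ν : 𝕁 → ℕ) {T : Finset 𝕁} {m : 𝕁} (hm : m ∉ T)
    (y : 𝕁 → ℝ) (t : ℝ) :
    legendreProd ν (insert m T) (Function.update y m t) =
      (legendre (ν m)).eval t * legendreProd ν T y := by
  rw [legendreProd, legendreProd, Finset.prod_insert hm, Function.update_self]
  congr 1
  refine Finset.prod_congr rfl fun j hj => ?_
  rw [Function.update_of_ne (by rintro rfl; exact hm hj)]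

theorem ofReal_update (y : 𝕁 → ℝ) (m : 𝕁) (t : ℝ) :
    (fun j => ((Function.update y m t j : ℝ) : ℂ)) =
      Function.update (fun j => (y j : ℂ)) m (t : ℂ) := by
  ext j
  by_cases h : j = m
  · subst h; simp
  · simp [Function.update_of_ne h]

/-- A function constant in `y_m` integrates to zero against `L_k(y_m)`, `k ≥ 1`, by orthogonality to
constants. -/
theorem integral_mul_legendreProd_eq_zero {ρ : 𝕁 → ℝ} {G : (𝕁 → ℂ) → ℂ} (hG : Measurable G)
    {M : ℝ} (hM : ∀ z ∈ polyStadium ρ, ‖G z‖ ≤ M) (ν : 𝕁 → ℕ) (T : Finset 𝕁) {m : 𝕁}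
    (hm : m ∈ T) (hν : 1 ≤ ν m)
    (hconst : ∀ y ∈ paramBox 𝕁, ∀ t ∈ Set.Icc (-1 : ℝ) 1,
      G (Function.update (fun j => (y j : ℂ)) m (t : ℂ)) = G fun j => y j) :
    ∫ y : 𝕁 → ℝ, G (fun j => y j) * (legendreProd ν T y : ℂ) ∂prior 𝕁 = 0 := by
  rw [integral_prior_eq_update (integrable_mul_legendreProd hG hM ν T) m]
  refine integral_eq_zero_of_ae ?_
  filter_upwards [ae_prior_mem] with y hy
  have h1 : ∀ᵐ t ∂unif, G (fun j => ((Function.update y m t j : ℝ) : ℂ)) *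
      (legendreProd ν T (Function.update y m t) : ℂ) =
      G (fun j => y j) * legendreProd ν (T.erase m) y * (((legendre (ν m)).eval t : ℝ) : ℂ) := by
    filter_upwards [ae_unif_mem] with t ht
    have := legendreProd_insert_update ν (Finset.notMem_erase m T) y t
    rw [Finset.insert_erase hm] at this
    rw [ofReal_update, hconst y hy t ht, this]
    push_cast; ring
  rw [integral_congr_ae h1, integral_const_mul, integral_complex_ofReal, integral_unif]
  have h2 := integral_legendre_mul_of_natDegree_lt (k := ν m) (p := 1)
    (by rw [Polynomial.natDegree_one]; omega)
  simp only [Polynomial.eval_one, mul_one] at h2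
  simp [h2]

/-- The size of a Legendre coefficient in terms of the axes of the Bernstein ellipse. -/
noncomputable def legendreDecay (r : ℝ) (k : ℕ) : ℝ :=
  2 * (semiAxisSum r / (semiAxisSum r - 1)) * (semiAxisSum r ^ k)⁻¹

/-- Decay of the Legendre coefficients of a separately holomorphic function. -/
theorem norm_integral_mul_legendreProd_le {ρ : 𝕁 → ℝ} (ν : 𝕁 → ℕ) {M : ℝ} (T : Finset 𝕁) :
    (∀ j ∈ T, 0 < ρ j ∧ 1 ≤ ν j) → ∀ G : (𝕁 → ℂ) → ℂ, Measurable G →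
    (∀ z ∈ polyStadium ρ, ‖G z‖ ≤ M) →
    (∀ z ∈ polyStadium ρ, ∀ j ∈ T,
      DifferentiableOn ℂ (fun ζ => G (Function.update z j ζ)) (stadium (ρ j))) →
    ‖∫ y : 𝕁 → ℝ, G (fun j => y j) * (legendreProd ν T y : ℂ) ∂prior 𝕁‖ ≤
      M * ∏ j ∈ T, legendreDecay (ρ j) (ν j) := by
  induction T using Finset.induction_on with
  | empty =>
    intro _ G hG hM _
    have := norm_integral_le_of_norm_le_const (μ := prior 𝕁)
      (f := fun y : 𝕁 → ℝ => G (fun j => y j) * (legendreProd ν ∅ y : ℂ)) (C := M) ?_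
    · simpa using this
    · filter_upwards [ae_prior_mem] with y hy
      simpa [legendreProd] using hM _ (ofReal_mem_polyStadium ρ hy)
  | insert m T hm ih =>
    intro hT G hG hM hd
    obtain ⟨hρm, hνm⟩ := hT m (Finset.mem_insert_self m T)
    have h1 := one_add_le_semiAxisSum (ρ m)
    set η := semiAxisSum (ρ m) with hη
    set z : ℝ → ℂ := fun φ => joukowski (circleMap 0 η φ) with hz
    have hη1 : 1 < η := by linarith
    have hzm : ∀ φ, z φ ∈ stadium (ρ m) := fun φ => by
      have := norm_circleMap_zero' (η := η) (by linarith) φ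
      exact joukowski_mem_stadium hρm.le (by rw [this]; exact hη1.le) this.le
    have hzc : Continuous z := by
      have := continuous_circleMap 0 η
      exact (this.add (this.inv₀ fun φ => circleMap_ne_center (by linarith))).div_const 2
    obtain ⟨B, hB0, hB⟩ := exists_legendreProd_bound ν T
    -- The `m`-th variable moves to the ellipse, and Fubini takes the contour integral outside. For
    -- fixed `φ` the induction hypothesis applies to `G` with coordinate `m` frozen at `z φ`, which
    -- obeys the same bound `M`; hence the induction is over all `G`.
    let I : Measure ℝ := volume.restrict (Set.Ioc 0 (2 * Real.pi))
    have hswap : Integrable (Function.uncurry fun (y : 𝕁 → ℝ) (φ : ℝ) =>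
        G (Function.update (fun j => (y j : ℂ)) m (z φ)) * legendreKernel (ν m) η φ *
          (legendreProd ν T y : ℂ)) ((prior 𝕁).prod I) := by
      refine Integrable.of_bound (C := M * legendreDecay (ρ m) (ν m) * B) ?_ ?_
      · refine Measurable.aestronglyMeasurable (Measurable.mul (Measurable.mul (hG.comp ?_) ?_) ?_)
        · refine measurable_pi_lambda _ fun j => ?_
          by_cases h : j = m
          · subst h
            have h' : Measurable fun p : (𝕁 → ℝ) × ℝ => z p.2 := hzc.measurable.comp measurable_snd
            simpa using h'
          · simp only [Function.update_of_ne h]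
            exact Complex.measurable_ofReal.comp ((measurable_pi_apply j).comp measurable_fst)
        · exact (continuous_legendreKernel hνm hη1).measurable.comp measurable_snd
        · exact Complex.measurable_ofReal.comp
            ((continuous_legendreProd ν T).measurable.comp measurable_fst)
      · filter_upwards [Measure.quasiMeasurePreserving_fst.ae (ae_prior_mem (𝕁 := 𝕁))] with p hp
        have h2 := hM _ (update_mem_polyStadium (ofReal_mem_polyStadium ρ hp) (hzm p.2))
        have h3 := norm_legendreKernel_le hνm hη1 p.2
        have h4 := hB _ hp
        simp only [Function.uncurry]
        rw [norm_mul, norm_mul, Complex.norm_real, Real.norm_eq_abs]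
        have h5 : 0 ≤ M := (norm_nonneg _).trans h2
        have h6 : 0 ≤ legendreDecay (ρ m) (ν m) := (norm_nonneg _).trans h3
        exact mul_le_mul (mul_le_mul h2 h3 (norm_nonneg _) h5) h4 (abs_nonneg _) (by positivity)
    have e1 : ∫ y : 𝕁 → ℝ, G (fun j => y j) * (legendreProd ν (insert m T) y : ℂ) ∂prior 𝕁 =
        (2 * Real.pi : ℝ)⁻¹ • ∫ y : 𝕁 → ℝ, ∫ φ,
          G (Function.update (fun j => (y j : ℂ)) m (z φ)) * legendreKernel (ν m) η φ *
          (legendreProd ν T y : ℂ) ∂I ∂prior 𝕁 := by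
      rw [integral_prior_eq_update (integrable_mul_legendreProd hG hM ν _) m, ← integral_smul]
      refine integral_congr_ae ?_
      filter_upwards [ae_prior_mem] with y hy
      have := integral_mul_legendre_eq hρm
        (hd _ (ofReal_mem_polyStadium ρ hy) m (Finset.mem_insert_self m T)) hνm
      rw [intervalIntegral.integral_of_le Real.two_pi_pos.le] at this
      simp only [ofReal_update, legendreProd_insert_update ν hm, Complex.ofReal_mul, ← mul_assoc]
      rw [integral_mul_const, integral_mul_const, this, smul_mul_assoc]
    rw [e1, integral_integral_swap hswap, norm_smul]
    have e2 : ∀ φ, ‖∫ y : 𝕁 → ℝ, G (Function.update (fun j => (y j : ℂ)) m (z φ)) *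
        legendreKernel (ν m) η φ * (legendreProd ν T y : ℂ) ∂prior 𝕁‖ ≤
        legendreDecay (ρ m) (ν m) * (M * ∏ j ∈ T, legendreDecay (ρ j) (ν j)) := by
      intro φ
      have h2 := ih (fun j hj => hT j (Finset.mem_insert_of_mem hj))
        (fun w => G (Function.update w m (z φ))) (hG.comp ?_)
        (fun w hw => hM _ (update_mem_polyStadium hw (hzm φ))) ?_
      · simp only [mul_comm (G _) (legendreKernel _ _ _), mul_assoc]
        rw [integral_const_mul, norm_mul]
        have h3 := norm_legendreKernel_le hνm hη1 φ
        exact mul_le_mul h3 h2 (norm_nonneg _) ((norm_nonneg _).trans h3)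
      · refine measurable_pi_lambda _ fun j => ?_
        by_cases h : j = m
        · subst h; simp
        · simpa only [Function.update_of_ne h] using measurable_pi_apply j
      · intro w hw j hj
        have hjm : j ≠ m := by rintro rfl; exact hm hj
        simp only [Function.update_comm hjm]
        exact hd _ (update_mem_polyStadium hw (hzm φ)) j (Finset.mem_insert_of_mem hj)
    have h7 := norm_integral_le_of_norm_le_const (μ := I) (Filter.Eventually.of_forall e2)
    have h8 : I.real Set.univ = 2 * Real.pi := by
      simp [I, measureReal_def, Real.pi_pos.le]
    rw [h8] at h7
    rw [Finset.prod_insert hm, Real.norm_of_nonneg (by positivity)]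
    calc _ ≤ (2 * Real.pi)⁻¹ * (legendreDecay (ρ m) (ν m) *
          (M * ∏ j ∈ T, legendreDecay (ρ j) (ν j)) * (2 * Real.pi)) := by gcongr
      _ = _ := by field_simp

end ProductMeasure
-- Complexification by duality, coercive inverses, Neumann perturbation.
section ComplexifiedDual

variable {H : Type*} [NormedAddCommGroup H] [InnerProductSpace ℝ H]

/-- Precomposition with a real operator, as an operator on the complexified dual. -/
noncomputable def precomp (A : H →L[ℝ] H) : (H →L[ℝ] ℂ) →L[ℂ] (H →L[ℝ] ℂ) :=
  LinearMap.mkContinuous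
    { toFun := fun φ => φ.comp A
      map_add' := fun φ χ => by ext; simp
      map_smul' := fun c φ => by ext; simp } ‖A‖ fun φ => by
        rw [mul_comm]; exact φ.opNorm_comp_le A

@[simp]
theorem precomp_apply (A : H →L[ℝ] H) (φ : H →L[ℝ] ℂ) (h : H) : precomp A φ h = φ (A h) := rfl

theorem norm_precomp_le (A : H →L[ℝ] H) : ‖precomp A‖ ≤ ‖A‖ :=
  LinearMap.mkContinuous_norm_le _ (norm_nonneg _) _

/-- Evaluation at a vector, as a functional on the complexified dual. -/
noncomputable def evalAt (h : H) : (H →L[ℝ] ℂ) →L[ℂ] ℂ :=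
  LinearMap.mkContinuous
    { toFun := fun φ => φ h
      map_add' := fun φ χ => rfl
      map_smul' := fun c φ => rfl } ‖h‖ fun φ => by
        rw [mul_comm]; exact φ.le_opNorm h

/-- Lax–Milgram, with the explicit bound from `α‖g‖² ≤ ⟨A g, g⟩ ≤ ‖A g‖ ‖g‖`. -/
theorem exists_inverse_of_coercive [CompleteSpace H] {A : H →L[ℝ] H} {α : ℝ} (hα : 0 < α)
    (hA : ∀ h, α * ‖h‖ ^ 2 ≤ inner ℝ (A h) h) :
    ∃ A' : H →L[ℝ] H, (∀ h, A (A' h) = h) ∧ (∀ h, A' (A h) = h) ∧ ‖A'‖ ≤ α⁻¹ := by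
  have hc : IsCoercive ((innerSL ℝ).comp A) := by
    refine ⟨α, hα, fun h => ?_⟩
    have := hA h
    simpa [pow_two, mul_assoc] using this
  have he : ∀ h, hc.continuousLinearEquivOfBilin h = A h := fun h =>
    ext_inner_right ℝ fun w => by simp
  refine ⟨hc.continuousLinearEquivOfBilin.symm, fun h => ?_, fun h => ?_, ?_⟩
  · rw [← he]; simp
  · rw [← he]; simp
  · refine ContinuousLinearMap.opNorm_le_bound _ (by positivity) fun h => ?_
    set g := hc.continuousLinearEquivOfBilin.symm h with hg
    have e : A g = h := by rw [← he, hg]; simp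
    change ‖g‖ ≤ _
    have h1 := (hA g).trans (real_inner_le_norm (A g) g)
    rw [e] at h1
    rcases (norm_nonneg g).eq_or_lt with h0 | h0
    · rw [← h0]; positivity
    · rw [inv_mul_eq_div, le_div_iff₀ hα]
      nlinarith

/-- Factor `a + Δ = a(1 + a'Δ)` with `‖a'Δ‖ ≤ 1/2`. The inverse `x` satisfies `x = a' - a'Δx`, so
`‖x‖ ≤ α⁻¹ + ‖x‖/2`. -/
theorem isUnit_add_of_norm_le {R : Type*} [NormedRing R] [HasSummableGeomSeries R]
    {a a' Δ : R} {α : ℝ} (hα : 0 < α) (h1 : a * a' = 1) (h2 : a' * a = 1) (ha' : ‖a'‖ ≤ α⁻¹)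
    (hΔ : ‖Δ‖ ≤ α / 2) : IsUnit (a + Δ) ∧ ‖Ring.inverse (a + Δ)‖ ≤ 2 / α := by
  have hs : ‖a' * Δ‖ ≤ 1 / 2 := by
    refine (norm_mul_le _ _).trans ?_
    calc ‖a'‖ * ‖Δ‖ ≤ α⁻¹ * (α / 2) := by gcongr
      _ = 1 / 2 := by field_simp
  have hu : IsUnit (a + Δ) := by
    have e : a + Δ = a * (1 - -(a' * Δ)) := by
      rw [sub_neg_eq_add, mul_add, mul_one, ← mul_assoc, h1, one_mul]
    rw [e]
    have ha : IsUnit a := ⟨⟨a, a', h1, h2⟩, rfl⟩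
    exact ha.mul
      (isUnit_one_sub_of_norm_lt_one (by rw [norm_neg]; linarith))
  refine ⟨hu, ?_⟩
  set x := Ring.inverse (a + Δ) with hx
  have e : x = a' - a' * Δ * x := by
    have h3 : (a + Δ) * x = 1 := Ring.mul_inverse_cancel _ hu
    calc x = a' * ((a + Δ) * x) - a' * Δ * x := by
            rw [add_mul, mul_add, ← mul_assoc a' a, h2, one_mul, mul_assoc a' Δ]; abel
      _ = _ := by rw [h3, mul_one]
  have h4 : ‖x‖ ≤ α⁻¹ + 1 / 2 * ‖x‖ := by
    calc ‖x‖ = ‖a' - a' * Δ * x‖ := by rw [← e]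
      _ ≤ ‖a'‖ + ‖a' * Δ * x‖ := norm_sub_le _ _
      _ ≤ ‖a'‖ + ‖a' * Δ‖ * ‖x‖ := by gcongr; exact norm_mul_le _ _
      _ ≤ _ := by gcongr
  rw [div_eq_mul_inv]
  linarith

theorem norm_le_of_mem_stadium {r : ℝ} (hr : 0 ≤ r) {z : ℂ} (hz : z ∈ stadium r) :
    ‖z‖ ≤ 1 + r := by
  obtain ⟨y, hy, h⟩ := (mem_stadium hr).1 hz
  have h1 : ‖(y : ℂ)‖ ≤ 1 := by
    rw [Complex.norm_real, Real.norm_eq_abs]; exact abs_le.2 hy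
  calc ‖z‖ = ‖(y : ℂ) + (z - y)‖ := by ring_nf
    _ ≤ _ := (norm_add_le _ _).trans (by gcongr)

end ComplexifiedDual

/-! ### Affine-parametric operators at complex parameters. -/

section ParametricOperator

variable {R : Type*} [NormedRing R] [NormedAlgebra ℂ R]
  {X : Type*} [NormedAddCommGroup X]
  {𝕁 : Set ℕ} (T : X →+ R) (abar : X) (ψ : 𝕁 → X)

/-- The affine-parametric operator `T ā + ∑ z_j T ψ_j` at a complex parameter `z`. -/
noncomputable def complexOp (z : 𝕁 → ℂ) : R := T abar + ∑' j, z j • T (ψ j)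

variable {T abar ψ} {ρ : 𝕁 → ℝ}

theorem norm_smul_map_le (hT : ∀ x, ‖T x‖ ≤ ‖x‖) (hρ : ∀ j, 0 ≤ ρ j) {z : 𝕁 → ℂ}
    (hz : z ∈ polyStadium ρ) (j : 𝕁) : ‖z j • T (ψ j)‖ ≤ ‖ψ j‖ + ρ j * ‖ψ j‖ := by
  rw [norm_smul, ← one_add_mul]
  exact mul_le_mul (norm_le_of_mem_stadium (hρ j) (hz j trivial)) (hT _)
    (norm_nonneg _) (by linarith [hρ j])

theorem summable_smul_map [CompleteSpace R] (hT : ∀ x, ‖T x‖ ≤ ‖x‖) (hψ : Summable fun j => ‖ψ j‖)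
    (hρ : ∀ j, 0 ≤ ρ j) (hρψ : Summable fun j => ρ j * ‖ψ j‖) {z : 𝕁 → ℂ}
    (hz : z ∈ polyStadium ρ) : Summable fun j => z j • T (ψ j) :=
  Summable.of_norm_bounded (hψ.add hρψ) (norm_smul_map_le hT hρ hz)

theorem continuousOn_complexOp [CompleteSpace R] (hT : ∀ x, ‖T x‖ ≤ ‖x‖) (hψ : Summable fun j => ‖ψ j‖)
    (hρ : ∀ j, 0 ≤ ρ j) (hρψ : Summable fun j => ρ j * ‖ψ j‖) :
    ContinuousOn (complexOp T abar ψ) (polyStadium ρ) := by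
  refine continuousOn_const.add (continuousOn_tsum (fun j => ?_) (hψ.add hρψ)
    fun j z hz => norm_smul_map_le hT hρ hz j)
  exact ((continuous_apply j).smul continuous_const).continuousOn

theorem complexOp_update [CompleteSpace R] (hT : ∀ x, ‖T x‖ ≤ ‖x‖) (hψ : Summable fun j => ‖ψ j‖)
    (hρ : ∀ j, 0 ≤ ρ j) (hρψ : Summable fun j => ρ j * ‖ψ j‖) {z : 𝕁 → ℂ}
    (hz : z ∈ polyStadium ρ) (m : 𝕁) (ζ : ℂ) :
    complexOp T abar ψ (Function.update z m ζ) =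
      complexOp T abar ψ z + (ζ - z m) • T (ψ m) := by
  have h := (summable_smul_map hT hψ hρ hρψ hz).hasSum.update m (ζ • T (ψ m))
  have e : (Function.update (fun j => z j • T (ψ j)) m (ζ • T (ψ m))) =
      fun j => Function.update z m ζ j • T (ψ j) := by
    ext1 j
    by_cases hj : j = m
    · subst hj; simp
    · simp [Function.update_of_ne hj]
  rw [e] at h
  rw [complexOp, complexOp, h.tsum_eq, sub_smul]
  abel

theorem complexOp_ofReal [NormedSpace ℝ X] [CompleteSpace X] (hT : ∀ x, ‖T x‖ ≤ ‖x‖)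
    (hTs : ∀ (c : ℝ) x, T (c • x) = (c : ℂ) • T x)
    (hψ : Summable fun j => ‖ψ j‖) {y : 𝕁 → ℝ} (hy : y ∈ paramBox 𝕁) :
    complexOp T abar ψ (fun j => y j) = T (abar + ∑' j, y j • ψ j) := by
  have hs : Summable fun j => y j • ψ j := by
    refine Summable.of_norm_bounded hψ fun j => ?_
    rw [norm_smul]
    exact mul_le_of_le_one_left (norm_nonneg _) (abs_le.2 (hy j trivial))
  have hc : Continuous T := AddMonoidHomClass.continuous_of_bound T 1 (by simpa using hT)
  have h := hs.hasSum.map T hc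
  simp only [Function.comp_def, hTs] at h
  rw [complexOp, h.tsum_eq, map_add]

/-- Perturb from a nearest real parameter: coordinatewise there is `y_j ∈ [-1,1]` with `|z_j - y_j|
≤ ρ_j`, and `y` is again admissible because `hinv` covers the whole box. -/
theorem isUnit_complexOp [CompleteSpace R] [NormedSpace ℝ X] [CompleteSpace X] {α : ℝ} (hα : 0 < α)
    (hT : ∀ x, ‖T x‖ ≤ ‖x‖) (hTs : ∀ (c : ℝ) x, T (c • x) = (c : ℂ) • T x)
    (hinv : ∀ y ∈ paramBox 𝕁, ∃ a' : R, T (abar + ∑' j, y j • ψ j) * a' = 1 ∧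
      a' * T (abar + ∑' j, y j • ψ j) = 1 ∧ ‖a'‖ ≤ α⁻¹)
    (hψ : Summable fun j => ‖ψ j‖)
    (hρ : ∀ j, 0 ≤ ρ j) (hρψ : Summable fun j => ρ j * ‖ψ j‖)
    (hρα : ∑' j, ρ j * ‖ψ j‖ ≤ α / 2) {z : 𝕁 → ℂ} (hz : z ∈ polyStadium ρ) :
    IsUnit (complexOp T abar ψ z) ∧ ‖Ring.inverse (complexOp T abar ψ z)‖ ≤ 2 / α := by
  choose y hy hyz using fun j => (mem_stadium (hρ j)).1 (hz j trivial)
  have hyb : y ∈ paramBox 𝕁 := fun j _ => hy j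
  obtain ⟨a', h1, h2, h3⟩ := hinv y hyb
  have hyp := ofReal_mem_polyStadium ρ hyb
  have hsz := summable_smul_map hT hψ hρ hρψ hz
  have hsy := summable_smul_map hT hψ hρ hρψ hyp
  have e : complexOp T abar ψ z = complexOp T abar ψ (fun j => y j) +
      ∑' j, (z j - y j) • T (ψ j) := by
    have := hsz.tsum_sub hsy
    simp only [sub_smul]
    rw [complexOp, complexOp, this]
    abel
  rw [e, complexOp_ofReal hT hTs hψ hyb]
  refine isUnit_add_of_norm_le hα h1 h2 h3 ?_
  refine le_trans (tsum_of_norm_bounded hρψ.hasSum fun j => ?_) hρα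
  rw [norm_smul]
  exact mul_le_mul (hyz j) (hT _) (norm_nonneg _) (hρ j)

end ParametricOperator

/-! ### Holomorphic extension of the posterior density. -/

section AbstractPosterior

variable {n : ℕ}

/-- The function `exp(-½ vᵀ A v)` of a complex vector `v`. -/
noncomputable def quadExp (A : Matrix (Fin n) (Fin n) ℝ) (v : Fin n → ℂ) : ℂ :=
  Complex.exp (-(1 / 2 * ∑ i, v i * ∑ j, (A i j : ℂ) * v j))

theorem differentiable_quadExp (A : Matrix (Fin n) (Fin n) ℝ) :
    Differentiable ℂ (quadExp A) := by
  unfold quadExp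
  fun_prop

theorem norm_quadExp_le (A : Matrix (Fin n) (Fin n) ℝ) {v : Fin n → ℂ} {b : Fin n → ℝ}
    (hv : ∀ i, ‖v i‖ ≤ b i) :
    ‖quadExp A v‖ ≤ Real.exp (1 / 2 * ∑ i, b i * ∑ j, |A i j| * b j) := by
  have hb : ∀ i, 0 ≤ b i := fun i => (norm_nonneg _).trans (hv i)
  refine (Complex.norm_exp_le_exp_norm _).trans (Real.exp_le_exp.2 ?_)
  rw [norm_neg, norm_mul]
  have h1 : ‖(1 / 2 : ℂ)‖ = 1 / 2 := by norm_num
  rw [h1]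
  gcongr
  refine (norm_sum_le _ _).trans (Finset.sum_le_sum fun i _ => ?_)
  rw [norm_mul]
  refine mul_le_mul (hv i) ?_ (norm_nonneg _) (hb i)
  refine (norm_sum_le _ _).trans (Finset.sum_le_sum fun j _ => ?_)
  rw [norm_mul, Complex.norm_real, Real.norm_eq_abs]
  exact mul_le_mul_of_nonneg_left (hv j) (abs_nonneg _)

variable {R : Type*} [NormedRing R] [NormedAlgebra ℂ R]
  {X : Type*} [NormedAddCommGroup X]
  {𝕁 : Set ℕ}

/-- The holomorphic extension of the posterior density, in terms of the inverse of the parametric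
operator and of the functionals `l k` of this inverse which give the observations. -/
noncomputable def complexPosterior (T : X →+ R) (abar : X) (ψ : 𝕁 → X)
    (l : Fin n → R →L[ℂ] ℂ) (A : Matrix (Fin n) (Fin n) ℝ) (δ : Fin n → ℝ) (z : 𝕁 → ℂ) : ℂ :=
  quadExp A fun k => δ k - l k (Ring.inverse (complexOp T abar ψ z))

/-- Decay of the Legendre coefficients of the posterior density of an affine-parametric operator
equation. -/
theorem exists_legendre_bound [CompleteSpace R] [NormedSpace ℝ X] [CompleteSpace X]
    {T : X →+ R} {abar : X} {ψ : 𝕁 → X} {α : ℝ} (hα : 0 < α)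
    (hT : ∀ x, ‖T x‖ ≤ ‖x‖) (hTs : ∀ (c : ℝ) x, T (c • x) = (c : ℂ) • T x)
    (hinv : ∀ y ∈ paramBox 𝕁, ∃ a' : R, T (abar + ∑' j, y j • ψ j) * a' = 1 ∧
      a' * T (abar + ∑' j, y j • ψ j) = 1 ∧ ‖a'‖ ≤ α⁻¹)
    (hψ : Summable fun j => ‖ψ j‖)
    (l : Fin n → R →L[ℂ] ℂ) (A : Matrix (Fin n) (Fin n) ℝ) (δ : Fin n → ℝ) :
    ∃ M, 0 < M ∧ ∀ ρ : 𝕁 → ℝ, (∀ j, 0 ≤ ρ j) → (Summable fun j => ρ j * ‖ψ j‖) →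
      ∑' j, ρ j * ‖ψ j‖ ≤ α / 2 → ∀ (ν : 𝕁 → ℕ) (S : Finset 𝕁),
      (∀ j ∈ S, 0 < ρ j ∧ 1 ≤ ν j) →
      Integrable (fun y : 𝕁 → ℝ => complexPosterior T abar ψ l A δ (fun j => y j) *
        (legendreProd ν S y : ℂ)) (prior 𝕁) ∧
      ‖∫ y : 𝕁 → ℝ, complexPosterior T abar ψ l A δ (fun j => y j) *
        (legendreProd ν S y : ℂ) ∂prior 𝕁‖ ≤ M * ∏ j ∈ S, legendreDecay (ρ j) (ν j) ∧
      ((∃ m ∈ S, ψ m = 0) →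
        ∫ y : 𝕁 → ℝ, complexPosterior T abar ψ l A δ (fun j => y j) *
          (legendreProd ν S y : ℂ) ∂prior 𝕁 = 0) := by
  -- Bounds the complex residuals through the inverse bound `2/α`. It does not involve `ρ`, so the
  -- final constant is independent of `ν`.
  set b : Fin n → ℝ := fun k => |δ k| + ‖l k‖ * (2 / α) with hb
  refine ⟨Real.exp (1 / 2 * ∑ i, b i * ∑ j, |A i j| * b j), Real.exp_pos _, ?_⟩
  intro ρ hρ hρψ hρα ν S hS
  set M := Real.exp (1 / 2 * ∑ i, b i * ∑ j, |A i j| * b j)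
  have hunit := fun z (hz : z ∈ polyStadium ρ) =>
    isUnit_complexOp hα hT hTs hinv hψ hρ hρψ hρα hz
  classical
  -- Continuity is known only on the closed polystadium; cutting off outside it yields a globally
  -- measurable function, with the same integrals because the prior lives on `U`.
  set G : (𝕁 → ℂ) → ℂ := (polyStadium ρ).indicator (complexPosterior T abar ψ l A δ) with hG
  have hGin : ∀ z ∈ polyStadium ρ, G z = complexPosterior T abar ψ l A δ z := fun z hz =>
    Set.indicator_of_mem hz _
  have hcont : ContinuousOn (complexPosterior T abar ψ l A δ) (polyStadium ρ) := by
    refine (differentiable_quadExp A).continuous.comp_continuousOn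
      (continuousOn_pi.2 fun k => continuousOn_const.sub
        ((l k).continuous.comp_continuousOn ?_))
    intro z hz
    obtain ⟨u, hu⟩ := (hunit z hz).1
    have := NormedRing.inverse_continuousAt u
    rw [hu] at this
    exact this.comp_continuousWithinAt (continuousOn_complexOp hT hψ hρ hρψ z hz)
  have hmeas : Measurable G := by
    have hm : MeasurableSet (polyStadium ρ) := (isClosed_polyStadium ρ).measurableSet
    refine measurable_of_restrict_of_restrict_compl hm ?_ ?_
    · have e : (polyStadium ρ).domRestrict G =
          (polyStadium ρ).domRestrict (complexPosterior T abar ψ l A δ) := by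
        ext z; exact hGin z z.2
      rw [e]
      exact (continuousOn_iff_continuous_domRestrict.1 hcont).measurable
    · have e : ((polyStadium ρ)ᶜ).domRestrict G = fun _ => 0 := by
        ext z; exact Set.indicator_of_notMem z.2 _
      rw [e]
      exact measurable_const
  have hbound : ∀ z ∈ polyStadium ρ, ‖G z‖ ≤ M := by
    intro z hz
    rw [hGin z hz]
    refine norm_quadExp_le A fun k => ?_
    refine (norm_sub_le _ _).trans (add_le_add ?_ ?_)
    · rw [Complex.norm_real, Real.norm_eq_abs]
    · exact ((l k).le_opNorm _).trans (mul_le_mul_of_nonneg_left (hunit z hz).2 (norm_nonneg _))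
  have hdiff : ∀ z ∈ polyStadium ρ, ∀ j ∈ S,
      DifferentiableOn ℂ (fun ζ => G (Function.update z j ζ)) (stadium (ρ j)) := by
    intro z hz j _
    have h1 : DifferentiableOn ℂ
        (fun ζ => complexPosterior T abar ψ l A δ (Function.update z j ζ)) (stadium (ρ j)) := by
      intro ζ hζ
      refine DifferentiableAt.differentiableWithinAt ?_
      have h2 : DifferentiableAt ℂ
          (fun ζ => Ring.inverse (complexOp T abar ψ (Function.update z j ζ))) ζ := by
        refine DifferentiableAt.fun_comp' ζ
          (differentiableAt_inverse (hunit _ (update_mem_polyStadium hz hζ)).1) ?_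
        simp only [complexOp_update hT hψ hρ hρψ hz]
        exact (differentiableAt_const _).add
          ((differentiableAt_id.sub (differentiableAt_const _)).smul_const _)
      have h3 : DifferentiableAt ℂ (fun ζ => fun k => (δ k : ℂ) -
          l k (Ring.inverse (complexOp T abar ψ (Function.update z j ζ)))) ζ :=
        differentiableAt_pi.2 fun k => (differentiableAt_const _).sub
          ((l k).differentiableAt.fun_comp' ζ h2)
      exact (differentiable_quadExp A _).fun_comp' ζ h3
    exact h1.congr fun ζ hζ => hGin _ (update_mem_polyStadium hz hζ)
  have hae : (fun y : 𝕁 → ℝ => G (fun j => y j) * (legendreProd ν S y : ℂ)) =ᵐ[prior 𝕁]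
      fun y : 𝕁 → ℝ => complexPosterior T abar ψ l A δ (fun j => y j) *
        (legendreProd ν S y : ℂ) := by
    filter_upwards [ae_prior_mem] with y hy
    rw [hGin _ (ofReal_mem_polyStadium ρ hy)]
  rw [← integral_congr_ae hae]
  refine ⟨(integrable_mul_legendreProd hmeas hbound ν S).congr hae,
    norm_integral_mul_legendreProd_le ν S hS G hmeas hbound hdiff, ?_⟩
  rintro ⟨m, hm, hψm⟩
  refine integral_mul_legendreProd_eq_zero hmeas hbound ν S hm (hS m hm).2 fun y hy t ht => ?_
  have hyp := ofReal_mem_polyStadium ρ hy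
  rw [hGin _ hyp, hGin _ (update_mem_polyStadium hyp (ofReal_mem_stadium _ ht)),
    complexPosterior, complexPosterior, complexOp_update hT hψ hρ hρψ hyp, hψm]
  simp

end AbstractPosterior

/-! ### Poincaré inequality and the gradient embedding of `H¹₀(D)`. -/

section EnergySpace

variable {d : ℕ} {D : Set (EuclideanSpace ℝ (Fin d))}

theorem lp_norm_sq_eq_integral {E : Type*} [NormedAddCommGroup E] [InnerProductSpace ℝ E]
    (g : Lp E 2 (volOn D)) : ‖g‖ ^ 2 = ∫ x in D, ‖g x‖ ^ 2 := by
  rw [← real_inner_self_eq_norm_sq, L2.inner_def]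
  simp only [real_inner_self_eq_norm_sq]

/-- The Poincaré inequality for smooth functions of compact support in a bounded set. -/
theorem integral_sq_le_integral_norm_gradient_sq (hd : 0 < d) {r : ℝ}
    (hD : ∀ x ∈ D, ‖x‖ ≤ r) {φ : EuclideanSpace ℝ (Fin d) → ℝ}
    (hφ : ContDiff ℝ ∞ φ) (hc : HasCompactSupport φ) (hsub : tsupport φ ⊆ D) :
    ∫ x, φ x ^ 2 ≤ 4 * r ^ 2 * ∫ x, ‖gradient φ x‖ ^ 2 := by
  set i : Fin d := ⟨0, hd⟩
  set e : EuclideanSpace ℝ (Fin d) := EuclideanSpace.single i 1 with he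
  set g : EuclideanSpace ℝ (Fin d) →L[ℝ] ℝ := EuclideanSpace.proj i with hg
  have hge : g e = 1 := by simp [hg, he]
  have hgx : ∀ x, |g x| ≤ ‖x‖ := fun x => by
    simpa [hg] using PiLp.norm_apply_le x i
  have hdφ : Differentiable ℝ φ := hφ.differentiable (by simp)
  have hcf : Continuous (fderiv ℝ φ) := hφ.continuous_fderiv (by simp)
  have hfd : ∀ x, fderiv ℝ (fun x => φ x ^ 2) x e = 2 * φ x * fderiv ℝ φ x e := fun x => by
    rw [fderiv_fun_pow _ (hdφ x)]; simp
  have hcg : Continuous fun x => ‖gradient φ x‖ ^ 2 := by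
    unfold gradient
    exact ((LinearIsometryEquiv.continuous _).comp hcf).norm.pow 2
  have hsupp : HasCompactSupport (fun x => ‖gradient φ x‖ ^ 2) := by
    refine (hc.fderiv ℝ).mono' (fun x hx => subset_tsupport _ ?_)
    rw [Function.mem_support] at hx ⊢
    contrapose! hx
    simp [gradient, hx]
  have hi0 : Integrable fun x => φ x ^ 2 :=
    (hφ.continuous.pow 2).integrable_of_hasCompactSupport
      (hc.mono fun x hx => by
        rw [Function.mem_support] at hx ⊢; contrapose! hx; simp [hx])
  have hi1 : Integrable fun x => ‖gradient φ x‖ ^ 2 := hcg.integrable_of_hasCompactSupport hsupp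
  have hi2 : Integrable fun x => g x * fderiv ℝ (fun x => φ x ^ 2) x e := by
    simp only [hfd]
    refine Continuous.integrable_of_hasCompactSupport ?_ (hc.mono fun x hx => ?_)
    · exact g.continuous.mul ((continuous_const.mul hφ.continuous).mul
        (hcf.clm_apply continuous_const))
    · rw [Function.mem_support] at hx ⊢; contrapose! hx; simp [hx]
  have hi3 : Integrable fun x => g x * φ x ^ 2 :=
    (g.continuous.mul (hφ.continuous.pow 2)).integrable_of_hasCompactSupport
      (hc.mono fun x hx => by
        rw [Function.mem_support] at hx ⊢; contrapose! hx; simp [hx])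
  -- Since `∂₁x₁ = 1`, `∫ φ² = -∫ 2 x₁ φ ∂₁φ`. Young's inequality absorbs `½ ∫ φ²` and leaves `2r² ∫
  -- |∇φ|²`.
  have key := integral_mul_fderiv_eq_neg_fderiv_mul_of_integrable (μ := volume)
    (f := fun x => g x) (g := fun x => φ x ^ 2) (v := e)
    (by simpa [hge] using hi0) hi2 hi3 (fun x _ => g.differentiableAt)
    (fun x _ => (hdφ x).pow 2)
  simp only [ContinuousLinearMap.fderiv, hge, one_mul, hfd] at key
  have hle : ∫ x, -(g x * (2 * φ x * fderiv ℝ φ x e)) ≤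
      ∫ x, (1 / 2 * φ x ^ 2 + 2 * r ^ 2 * ‖gradient φ x‖ ^ 2) := by
    refine integral_mono ?_ ((hi0.const_mul _).add (hi1.const_mul _)) fun x => ?_
    · simp only [hfd] at hi2; exact hi2.neg
    · by_cases hx : φ x = 0
      · simp only [hx]; simp; positivity
      · have hxD : x ∈ D := hsub (subset_tsupport _ hx)
        have h1 : |g x| ≤ r := (hgx x).trans (hD x hxD)
        have h2 : |fderiv ℝ φ x e| ≤ ‖gradient φ x‖ := by
          rw [← inner_gradient_left]
          refine (abs_real_inner_le_norm _ _).trans ?_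
          simp [he]
        have h3 : |g x * fderiv ℝ φ x e| ≤ r * ‖gradient φ x‖ := by
          rw [abs_mul]
          exact mul_le_mul h1 h2 (abs_nonneg _) ((abs_nonneg _).trans h1)
        have h4 : (g x * fderiv ℝ φ x e) ^ 2 ≤ (r * ‖gradient φ x‖) ^ 2 := by
          rw [← sq_abs]; gcongr
        simp only
        nlinarith [sq_nonneg (φ x + 2 * (g x * fderiv ℝ φ x e))]
  rw [integral_neg, integral_add (hi0.const_mul _) (hi1.const_mul _), integral_const_mul,
    integral_const_mul, key] at hle
  linarith

theorem norm_fst_le_of_mem_testPairs (hd : 0 < d) {r : ℝ} (hr : 0 ≤ r) (hD : ∀ x ∈ D, ‖x‖ ≤ r)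
    {w : L2Pair D} (hw : w ∈ testPairs D) : ‖w.fst‖ ≤ 2 * r * ‖w.snd‖ := by
  obtain ⟨φ, hφ, hc, hsub, h1, h2⟩ := hw
  refine abs_le_of_sq_le_sq' ?_ (by positivity) |>.2
  have h := integral_sq_le_integral_norm_gradient_sq hd hD hφ hc hsub
  have e1 : ‖w.fst‖ ^ 2 = ∫ x, φ x ^ 2 := by
    rw [lp_norm_sq_eq_integral, ← setIntegral_eq_integral_of_forall_compl_eq_zero (s := D)
      (f := fun x => φ x ^ 2)]
    · refine integral_congr_ae ?_
      filter_upwards [h1] with x hx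
      rw [hx, Real.norm_eq_abs, sq_abs]
    · intro x hx
      have : φ x = 0 := by
        by_contra hne; exact hx (hsub (subset_tsupport _ hne))
      simp [this]
  have e2 : ‖w.snd‖ ^ 2 = ∫ x, ‖gradient φ x‖ ^ 2 := by
    rw [lp_norm_sq_eq_integral, ← setIntegral_eq_integral_of_forall_compl_eq_zero (s := D)
      (f := fun x => ‖gradient φ x‖ ^ 2)]
    · refine integral_congr_ae ?_
      filter_upwards [h2] with x hx
      rw [hx]
    · intro x hx
      have : fderiv ℝ φ x = 0 := by
        by_contra hne; exact hx (hsub (support_fderiv_subset ℝ hne))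
      simp [gradient, this]
  rw [e1, mul_pow, e2]
  linarith

theorem norm_fst_le_of_mem_H10 (hd : 0 < d) {r : ℝ} (hr : 0 ≤ r) (hD : ∀ x ∈ D, ‖x‖ ≤ r)
    {w : L2Pair D} (hw : w ∈ H10 D) : ‖w.fst‖ ≤ 2 * r * ‖w.snd‖ := by
  have hcl : IsClosed {w : L2Pair D | ‖w.fst‖ ≤ 2 * r * ‖w.snd‖} :=
    isClosed_le (WithLp.fstL 2 ℝ _ _).continuous.norm
      (continuous_const.mul (WithLp.sndL 2 ℝ _ _).continuous.norm)
  exact closure_minimal (fun w hw => norm_fst_le_of_mem_testPairs hd hr hD hw) hcl hw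

/-- The weak gradient as a bounded operator on `H¹₀(D)`. -/
noncomputable def weakGradL (D : Set (EuclideanSpace ℝ (Fin d))) :
    H10 D →L[ℝ] Lp (EuclideanSpace ℝ (Fin d)) 2 (volOn D) :=
  (WithLp.sndL 2 ℝ _ _).comp (H10 D).subtypeL

instance : CompleteSpace (H10 D) :=
  (Submodule.isClosed_topologicalClosure _).completeSpace_coe

/-- Poincaré bounds the full `H¹` norm by that of the gradient, so the gradient map is injective
with closed range. -/
theorem exists_antilipschitz_weakGradL (hd : 0 < d) (hD : Bornology.IsBounded D) :
    ∃ K, AntilipschitzWith K (weakGradL D) := by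
  obtain ⟨r, hr⟩ := hD.exists_norm_le
  set R := |r|
  have hR : ∀ x ∈ D, ‖x‖ ≤ R := fun x hx => (hr x hx).trans (le_abs_self r)
  refine ⟨(Real.sqrt (4 * R ^ 2 + 1)).toNNReal, ContinuousLinearMap.antilipschitz_of_bound _
    fun v => ?_⟩
  rw [Real.coe_toNNReal _ (Real.sqrt_nonneg _)]
  refine abs_le_of_sq_le_sq' ?_ (by positivity) |>.2
  rw [mul_pow, Real.sq_sqrt (by positivity)]
  have h1 := WithLp.prod_norm_sq_eq_of_L2 (v : L2Pair D)
  have h2 := norm_fst_le_of_mem_H10 hd (abs_nonneg r) hR v.2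
  have h3 : ‖(v : L2Pair D).fst‖ ^ 2 ≤ (2 * R * ‖(v : L2Pair D).snd‖) ^ 2 := by gcongr
  change ‖(v : L2Pair D)‖ ^ 2 ≤ _ * ‖(v : L2Pair D).snd‖ ^ 2
  rw [h1]
  linarith

/-- Multiplication by a bounded coefficient, on square integrable vector fields. -/
noncomputable def mulCoeff (D : Set (EuclideanSpace ℝ (Fin d))) :
    LInf D →L[ℝ] Lp (EuclideanSpace ℝ (Fin d)) 2 (volOn D) →L[ℝ]
      Lp (EuclideanSpace ℝ (Fin d)) 2 (volOn D) :=
  (ContinuousLinearMap.lsmul ℝ ℝ).holderL (volOn D) ∞ 2 2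

theorem norm_mulCoeff_le (u : LInf D) : ‖mulCoeff D u‖ ≤ ‖u‖ := by
  refine ((mulCoeff D).le_opNorm u).trans (mul_le_of_le_one_left (norm_nonneg _) ?_)
  exact (ContinuousLinearMap.norm_holderL_le _).trans ContinuousLinearMap.opNorm_lsmul_le

theorem coeFn_mulCoeff (u : LInf D) (g : Lp (EuclideanSpace ℝ (Fin d)) 2 (volOn D)) :
    mulCoeff D u g =ᵐ[volOn D] fun x => u x • g x :=
  ContinuousLinearMap.coeFn_holder (ContinuousLinearMap.lsmul ℝ ℝ) u g

theorem inner_mulCoeff (u : LInf D) (g h : Lp (EuclideanSpace ℝ (Fin d)) 2 (volOn D)) :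
    inner ℝ (mulCoeff D u g) h = ∫ x in D, u x * inner ℝ (g x) (h x) := by
  rw [L2.inner_def]
  refine integral_congr_ae ?_
  filter_upwards [coeFn_mulCoeff u g] with x hx
  rw [hx, real_inner_smul_left]

theorem mul_norm_sq_le_inner_mulCoeff {u : LInf D} {α : ℝ}
    (hu : ∀ᵐ x ∂(volOn D), α ≤ u x) (g : Lp (EuclideanSpace ℝ (Fin d)) 2 (volOn D)) :
    α * ‖g‖ ^ 2 ≤ inner ℝ (mulCoeff D u g) g := by
  rw [← real_inner_self_eq_norm_sq, L2.inner_def, L2.inner_def, ← integral_const_mul]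
  refine integral_mono_ae ((L2.integrable_inner g g).const_mul _)
    (L2.integrable_inner _ _) ?_
  filter_upwards [coeFn_mulCoeff u g, hu] with x hx hux
  rw [hx, real_inner_smul_left]
  exact mul_le_mul_of_nonneg_right hux real_inner_self_nonneg

end EnergySpace

/-! ### The complex Banach algebra acting on the complexified dual. -/

section OperatorAlgebra

variable {H : Type*} [NormedAddCommGroup H] [InnerProductSpace ℝ H]

/-- The operators on the complexified dual of a real Hilbert space. -/
abbrev DualOp (H : Type*) [NormedAddCommGroup H] [InnerProductSpace ℝ H] : Type _ :=
  (H →L[ℝ] ℂ) →L[ℂ] (H →L[ℝ] ℂ)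

noncomputable instance : NormedRing (DualOp H) := ContinuousLinearMap.toNormedRing

noncomputable instance : NormedAlgebra ℂ (DualOp H) := ContinuousLinearMap.toNormedAlgebra

/-- `precomp` as an additive map. -/
noncomputable def precompHom : (H →L[ℝ] H) →+ DualOp H where
  toFun := precomp
  map_zero' := by ext φ g; simp
  map_add' A B := by ext φ g; simp

theorem precomp_smul (c : ℝ) (A : H →L[ℝ] H) : precomp (c • A) = (c : ℂ) • precomp A := by
  ext φ g
  simp

theorem precomp_mul_precomp (A B : H →L[ℝ] H) (h : ∀ g, B (A g) = g) :
    precomp A * precomp B = 1 := by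
  ext φ g
  change φ (B (A g)) = φ g
  rw [h]

/-- The functional `S ↦ (S F)(e)` on the operators on the complexified dual. -/
noncomputable def entryAt (F : H →L[ℝ] ℂ) (g : H) : DualOp H →L[ℂ] ℂ :=
  (evalAt g).comp (ContinuousLinearMap.apply ℂ (H →L[ℝ] ℂ) F)

theorem entryAt_apply (F : H →L[ℝ] ℂ) (g : H) (S : DualOp H) : entryAt F g S = S F g := rfl

theorem inverse_precomp_apply {A A' : H →L[ℝ] H} (h1 : ∀ g, A (A' g) = g)
    (h2 : ∀ g, A' (A g) = g) (F : H →L[ℝ] ℂ) : Ring.inverse (precomp A : DualOp H) F = F.comp A' := by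
  have := Ring.inverse_unit (⟨precomp A, precomp A', precomp_mul_precomp A A' h2,
    precomp_mul_precomp A' A h1⟩ : (DualOp H)ˣ)
  exact congrArg (fun S : DualOp H => S F) this

end OperatorAlgebra

/-! ### The elliptic operator on gradient fields. -/

section EllipticOperator

variable {d : ℕ} {D : Set (EuclideanSpace ℝ (Fin d))}
  {H : Type*} [NormedAddCommGroup H] [InnerProductSpace ℝ H] [CompleteSpace H]

/-- The elliptic operator with coefficient `u`, on a Hilbert space `H` of square integrable vector
fields. -/
noncomputable def ellipticOp (ι : H →ₗᵢ[ℝ] Lp (EuclideanSpace ℝ (Fin d)) 2 (volOn D)) :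
    LInf D →+ (H →L[ℝ] H) where
  toFun u := (ContinuousLinearMap.adjoint ι.toContinuousLinearMap).comp
    ((mulCoeff D u).comp ι.toContinuousLinearMap)
  map_zero' := by ext; simp
  map_add' u v := by ext; simp

variable {ι : H →ₗᵢ[ℝ] Lp (EuclideanSpace ℝ (Fin d)) 2 (volOn D)}

theorem ellipticOp_smul (c : ℝ) (u : LInf D) : ellipticOp ι (c • u) = c • ellipticOp ι u := by
  ext
  simp [ellipticOp]

theorem ellipticOp_apply (u : LInf D) (g : H) :
    ellipticOp ι u g =
      ContinuousLinearMap.adjoint ι.toContinuousLinearMap (mulCoeff D u (ι g)) := rfl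

theorem inner_ellipticOp (u : LInf D) (g h : H) :
    inner ℝ (ellipticOp ι u g) h = inner ℝ (mulCoeff D u (ι g)) (ι h) := by
  rw [ellipticOp_apply, ContinuousLinearMap.adjoint_inner_left,
    LinearIsometry.coe_toContinuousLinearMap]

theorem norm_ellipticOp_le (u : LInf D) : ‖ellipticOp ι u‖ ≤ ‖u‖ := by
  refine ContinuousLinearMap.opNorm_le_bound _ (norm_nonneg _) fun g => ?_
  have h1 : ‖ContinuousLinearMap.adjoint ι.toContinuousLinearMap‖ ≤ 1 := by
    rw [LinearIsometryEquiv.norm_map]; exact ι.norm_toContinuousLinearMap_le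
  rw [ellipticOp_apply]
  calc ‖_‖ ≤ 1 * ‖mulCoeff D u (ι g)‖ :=
        (ContinuousLinearMap.le_opNorm _ _).trans
          (mul_le_mul_of_nonneg_right h1 (norm_nonneg _))
    _ ≤ ‖mulCoeff D u‖ * ‖ι g‖ := by rw [one_mul]; exact (mulCoeff D u).le_opNorm _
    _ ≤ _ := by rw [ι.norm_map]; exact mul_le_mul_of_nonneg_right (norm_mulCoeff_le u) (norm_nonneg _)

theorem exists_inverse_ellipticOp {u : LInf D} {α : ℝ} (hα : 0 < α)
    (hu : ∀ᵐ x ∂(volOn D), α ≤ u x) :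
    ∃ A' : H →L[ℝ] H, (∀ h, ellipticOp ι u (A' h) = h) ∧ (∀ h, A' (ellipticOp ι u h) = h) ∧
      ‖A'‖ ≤ α⁻¹ :=
  exists_inverse_of_coercive hα fun h => by
    rw [inner_ellipticOp, ← ι.norm_map]
    exact mul_norm_sq_le_inner_mulCoeff hu _

theorem isWeakSolution_iff (e : H10 D ≃L[ℝ] H) (he : ∀ v, ι (e v) = weakGrad v)
    (f : H10 D →L[ℝ] ℝ) (u : LInf D) (p : H10 D) :
    IsWeakSolution f u p ↔ ∀ h : H, inner ℝ (e p) (ellipticOp ι u h) = f (e.symm h) := by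
  have key : ∀ q : H10 D, ∫ x in D, u x * inner ℝ (weakGrad p x) (weakGrad q x) =
      inner ℝ (e p) (ellipticOp ι u (e q)) := fun q => by
    rw [real_inner_comm, inner_ellipticOp, he, he, inner_mulCoeff]
    simp only [real_inner_comm]
  constructor
  · intro hp h
    rw [← hp (e.symm h), key, e.apply_symm_apply]
  · intro hp q
    rw [key, hp, e.symm_apply_apply]

/-- A weak solution exists, and its image under `o` is an entry of the inverse of the
elliptic operator. -/
theorem entryAt_inverse_ellipticOp (e : H10 D ≃L[ℝ] H) (he : ∀ v, ι (e v) = weakGrad v)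
    (f o : H10 D →L[ℝ] ℝ) {u : LInf D} {α : ℝ} (hα : 0 < α)
    (hu : ∀ᵐ x ∂(volOn D), α ≤ u x) :
    entryAt (Complex.ofRealCLM.comp (f.comp (e.symm : H →L[ℝ] H10 D)))
      ((InnerProductSpace.toDual ℝ H).symm (o.comp (e.symm : H →L[ℝ] H10 D)))
      (Ring.inverse (precompHom (ellipticOp ι u))) = (o (forwardMap f u) : ℂ) := by
  obtain ⟨A', h1, h2, -⟩ := exists_inverse_ellipticOp (ι := ι) hα hu
  have hex : ∃ p, IsWeakSolution f u p := by
    -- The Riesz representative of `f ∘ e⁻¹ ∘ A'`: paired with `A h` it gives `f (e⁻¹ h)`.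
    refine ⟨e.symm ((InnerProductSpace.toDual ℝ H).symm
      ((f.comp (e.symm : H →L[ℝ] H10 D)).comp A')), (isWeakSolution_iff e he f u _).2 fun h => ?_⟩
    rw [e.apply_symm_apply, InnerProductSpace.toDual_symm_apply]
    simp [h2]
  have hp : IsWeakSolution f u (forwardMap f u) := by
    rw [forwardMap, dif_pos hex]; exact hex.choose_spec
  rw [isWeakSolution_iff e he] at hp
  rw [entryAt_apply]
  change (Ring.inverse (precomp (ellipticOp ι u) : DualOp H) _) _ = _
  rw [inverse_precomp_apply h1 h2]
  change ((f (e.symm (A' _)) : ℝ) : ℂ) = _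
  -- With `g` representing `o`: `f(e⁻¹ A' g) = ⟨e p, A A' g⟩ = ⟨e p, g⟩ = o(p)`. Only the weak
  -- equation enters, so the choice of solution is immaterial.
  rw [← hp, h1, real_inner_comm, InnerProductSpace.toDual_symm_apply]
  simp

end EllipticOperator

/-! ### Application to the Bayesian problem. -/

section PosteriorDecay

variable {d n : ℕ} {D : Set (EuclideanSpace ℝ (Fin d))} {𝕁 : Set ℕ}

/-- The weak gradients of the elements of `H¹₀(D)` form a closed subspace isomorphic to it. -/
theorem exists_gradient_space (hd : 0 < d) (hD : Bornology.IsBounded D) :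
    ∃ (S : Submodule ℝ (Lp (EuclideanSpace ℝ (Fin d)) 2 (volOn D))) (_ : CompleteSpace S)
      (e : H10 D ≃L[ℝ] S), ∀ v, (e v : Lp (EuclideanSpace ℝ (Fin d)) 2 (volOn D)) = weakGrad v := by
  obtain ⟨C, hC⟩ := exists_antilipschitz_weakGradL hd hD
  have hcl : IsClosed (Set.range (weakGradL D)) :=
    hC.isClosed_range (weakGradL D).uniformContinuous
  exact ⟨(weakGradL D).range, hcl.completeSpace_coe,
    (weakGradL D).equivRange hC.injective hcl, fun v => rfl⟩

theorem quadExp_ofReal (A : Matrix (Fin n) (Fin n) ℝ) (v : Fin n → ℝ) :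
    quadExp A (fun k => (v k : ℂ)) = (Real.exp (-(1 / 2 * (v ⬝ᵥ A.mulVec v))) : ℝ) := by
  simp only [quadExp, dotProduct, Matrix.mulVec]
  push_cast
  rfl

theorem ofReal_legendreCoeff (Θ : (𝕁 → ℝ) → ℝ) (ν : 𝕁 →₀ ℕ) :
    (legendreCoeff Θ ν : ℂ) =
      ∫ y, (Θ y : ℂ) * (legendreProd ν ν.support y : ℂ) ∂prior 𝕁 := by
  rw [legendreCoeff, Measure.restrict_eq_self_of_ae_mem ae_prior_mem, ← integral_complex_ofReal]
  simp only [Complex.ofReal_mul]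
  rfl

/-- As `ι` is isometric, the operator norm is at most `‖u‖` and coercivity holds with `a_min`
itself, so no Poincaré constant enters the condition on `ρ`. -/
theorem exists_posterior_bound_of_equiv {H : Type*} [NormedAddCommGroup H]
    [InnerProductSpace ℝ H] [CompleteSpace H]
    (ι : H →ₗᵢ[ℝ] Lp (EuclideanSpace ℝ (Fin d)) 2 (volOn D))
    (e : H10 D ≃L[ℝ] H) (he : ∀ v, ι (e v) = weakGrad v)
    (f : H10 D →L[ℝ] ℝ) (o : Fin n → (H10 D →L[ℝ] ℝ)) (Γ : Matrix (Fin n) (Fin n) ℝ)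
    (δ : Fin n → ℝ) (abar : LInf D) (ψ : 𝕁 → LInf D) (hψ : Summable fun j => ‖ψ j‖)
    {amin amax : ℝ} (hUEA : UEA abar ψ amin amax) :
    ∃ M, 0 < M ∧ ∀ ρ : 𝕁 → ℝ, (∀ j, 0 ≤ ρ j) → (Summable fun j => ρ j * ‖ψ j‖) →
      ∑' j, ρ j * ‖ψ j‖ ≤ amin / 2 → ∀ ν : 𝕁 →₀ ℕ, (∀ j ∈ ν.support, 0 < ρ j) →
      IntegrableOn (fun y => posterior f o Γ δ abar ψ y * legendreTensor ν y)
        (paramBox 𝕁) (prior 𝕁) ∧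
      |legendreCoeff (posterior f o Γ δ abar ψ) ν| ≤
        M * ∏ j ∈ ν.support, legendreDecay (ρ j) (ν j) ∧
      ((∃ m ∈ ν.support, ψ m = 0) → legendreCoeff (posterior f o Γ δ abar ψ) ν = 0) := by
  obtain ⟨hα, hU⟩ := hUEA
  have hu : ∀ y ∈ paramBox 𝕁, ∀ᵐ x ∂(volOn D), amin ≤ coeff abar ψ y x := fun y hy =>
    (hU y hy).mono fun x hx => hx.1
  set T : LInf D →+ DualOp H := precompHom.comp (ellipticOp ι) with hTdef
  have hT : ∀ u, ‖T u‖ ≤ ‖u‖ := fun u => (norm_precomp_le _).trans (norm_ellipticOp_le u)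
  have hTs : ∀ (c : ℝ) u, T (c • u) = (c : ℂ) • T u := fun c u => by
    change precomp (ellipticOp ι (c • u)) = _
    rw [ellipticOp_smul, precomp_smul]
    rfl
  set l : Fin n → DualOp H →L[ℂ] ℂ := fun k =>
    entryAt (Complex.ofRealCLM.comp (f.comp (e.symm : H →L[ℝ] H10 D)))
      ((InnerProductSpace.toDual ℝ H).symm ((o k).comp (e.symm : H →L[ℝ] H10 D)))
  have hinv : ∀ y ∈ paramBox 𝕁, ∃ a' : DualOp H, T (abar + ∑' j, y j • ψ j) * a' = 1 ∧
      a' * T (abar + ∑' j, y j • ψ j) = 1 ∧ ‖a'‖ ≤ amin⁻¹ := fun y hy => by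
    obtain ⟨A', h1, h2, h3⟩ := exists_inverse_ellipticOp (ι := ι) hα (hu y hy)
    exact ⟨precomp A', precomp_mul_precomp _ _ h2, precomp_mul_precomp _ _ h1,
      (norm_precomp_le _).trans h3⟩
  have hpost : ∀ y ∈ paramBox 𝕁, complexPosterior T abar ψ l Γ⁻¹ δ (fun j => y j) =
      (posterior f o Γ δ abar ψ y : ℂ) := fun y hy => by
    rw [complexPosterior, complexOp_ofReal hT hTs hψ hy, posterior, potential, ← quadExp_ofReal]
    congr 1
    ext k
    have := entryAt_inverse_ellipticOp e he f (o k) hα (hu y hy)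
    rw [Pi.sub_apply, Complex.ofReal_sub, obsMap, ← this]
    rfl
  obtain ⟨M, hM0, hM⟩ := exists_legendre_bound hα hT hTs hinv hψ l Γ⁻¹ δ
  refine ⟨M, hM0, fun ρ hρ hρψ hρα ν hν => ?_⟩
  obtain ⟨h1, h2, h3⟩ := hM ρ hρ hρψ hρα ν ν.support fun j hj =>
    ⟨hν j hj, Nat.one_le_iff_ne_zero.2 (Finsupp.mem_support_iff.1 hj)⟩
  have hae : (fun y : 𝕁 → ℝ => complexPosterior T abar ψ l Γ⁻¹ δ (fun j => y j) *
      (legendreProd ν ν.support y : ℂ)) =ᵐ[prior 𝕁]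
      fun y => (posterior f o Γ δ abar ψ y : ℂ) * (legendreProd ν ν.support y : ℂ) := by
    filter_upwards [ae_prior_mem] with y hy
    rw [hpost y hy]
  rw [integral_congr_ae hae, ← ofReal_legendreCoeff] at h2 h3
  refine ⟨?_, ?_, fun h => by exact_mod_cast h3 h⟩
  · rw [IntegrableOn, Measure.restrict_eq_self_of_ae_mem ae_prior_mem]
    refine ((h1.congr hae).re).congr (Filter.Eventually.of_forall fun y => ?_)
    simp only [← Complex.ofReal_mul]
    rfl
  · rwa [Complex.norm_real, Real.norm_eq_abs] at h2

theorem exists_posterior_bound (hd : 0 < d) (hD : Bornology.IsBounded D)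
    (f : H10 D →L[ℝ] ℝ) (o : Fin n → (H10 D →L[ℝ] ℝ)) (Γ : Matrix (Fin n) (Fin n) ℝ)
    (δ : Fin n → ℝ) (abar : LInf D) (ψ : 𝕁 → LInf D) (hψ : Summable fun j => ‖ψ j‖)
    {amin amax : ℝ} (hUEA : UEA abar ψ amin amax) :
    ∃ M, 0 < M ∧ ∀ ρ : 𝕁 → ℝ, (∀ j, 0 ≤ ρ j) → (Summable fun j => ρ j * ‖ψ j‖) →
      ∑' j, ρ j * ‖ψ j‖ ≤ amin / 2 → ∀ ν : 𝕁 →₀ ℕ, (∀ j ∈ ν.support, 0 < ρ j) →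
      IntegrableOn (fun y => posterior f o Γ δ abar ψ y * legendreTensor ν y)
        (paramBox 𝕁) (prior 𝕁) ∧
      |legendreCoeff (posterior f o Γ δ abar ψ) ν| ≤
        M * ∏ j ∈ ν.support, legendreDecay (ρ j) (ν j) ∧
      ((∃ m ∈ ν.support, ψ m = 0) → legendreCoeff (posterior f o Γ δ abar ψ) ν = 0) := by
  obtain ⟨S, hS, e, he⟩ := exists_gradient_space hd hD
  exact exists_posterior_bound_of_equiv S.subtypeₗᵢ e he f o Γ δ abar ψ hψ hUEA

/-! ### Admissibility of the prescribed radii. -/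

variable {ψ : 𝕁 → LInf D} {amin K : ℝ} {J₀ : ℕ}

theorem le_radius (hα : 0 < amin) (hK1 : K < 1) (ν : 𝕁 →₀ ℕ) (m : 𝕁) :
    K ≤ radius ψ amin K J₀ ν m := by
  unfold radius
  split_ifs
  · exact le_rfl
  · have : 0 ≤ amin * ν m / (4 * normF J₀ ν * ‖ψ m‖) := by positivity
    linarith

/-- `x/(x-1)` is decreasing and `η ≥ 1 + r ≥ 1 + K`. -/
theorem legendreDecay_le (hK0 : 0 < K) {r : ℝ} (hr : K ≤ r) (k : ℕ) :
    legendreDecay r k ≤ 2 * (1 + K) / K * (semiAxisSum r ^ k)⁻¹ := by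
  have h := one_add_le_semiAxisSum r
  have h1 : 0 < semiAxisSum r - 1 := by linarith
  rw [legendreDecay]
  refine mul_le_mul_of_nonneg_right ?_ (inv_nonneg.2 (pow_nonneg (by linarith) _))
  rw [← mul_div_assoc, div_le_div_iff₀ h1 hK0]
  nlinarith

theorem radius_mul_norm_le (hα : 0 < amin) (hK0 : 0 < K) (ν : 𝕁 →₀ ℕ) (m : 𝕁) :
    radius ψ amin K J₀ ν m * ‖ψ m‖ ≤
      K * ‖ψ m‖ + if J₀ < (m : ℕ) then ‖ψ m‖ + amin / 4 * (ν m / normF J₀ ν) else 0 := by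
  unfold radius
  by_cases h : (m : ℕ) ≤ J₀
  · rw [if_pos h, if_neg (not_lt.2 h), add_zero]
  · rw [if_neg h, if_pos (not_le.1 h)]
    have h1 : amin * ν m / (4 * normF J₀ ν * ‖ψ m‖) * ‖ψ m‖ ≤ amin / 4 * (ν m / normF J₀ ν) := by
      rcases eq_or_ne ‖ψ m‖ 0 with h0 | h0
      · rw [h0, mul_zero]; positivity
      · rw [div_mul_eq_div_div, div_mul_cancel₀ _ h0]
        apply le_of_eq; ring
    have h2 : 0 ≤ K * ‖ψ m‖ := by positivity
    rw [add_mul, one_mul]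
    linarith

/-- Three contributions: the `K` part is below `a_min/8`, the summand `1` in the tail radii costs at
most `a_min/24`, and the fractions `ν_j/|ν_F|` sum to at most 1, costing `a_min/4`. -/
theorem sum_radius_mul_norm_le (hψ : Summable fun j => ‖ψ j‖) (hα : 0 < amin) (hK0 : 0 < K)
    (hK : K * ∑' j, ‖ψ j‖ < amin / 8)
    (hJ₀ : ∑' j : {j : 𝕁 // J₀ < (j : ℕ)}, ‖ψ j‖ < amin * K / (24 * (1 + K))) (ν : 𝕁 →₀ ℕ) :
    ∑ j ∈ ν.support, radius ψ amin K J₀ ν j * ‖ψ j‖ ≤ amin / 2 := by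
  have h1 : ∑ j ∈ ν.support, ‖ψ j‖ ≤ ∑' j, ‖ψ j‖ :=
    hψ.sum_le_tsum _ fun j _ => norm_nonneg _
  have h2 : ∑ j ∈ ν.support.filter (fun j : 𝕁 => J₀ < (j : ℕ)), ‖ψ j‖ ≤
      ∑' j : {j : 𝕁 // J₀ < (j : ℕ)}, ‖ψ j‖ := by
    rw [← Finset.sum_subtype_eq_sum_filter]
    exact (hψ.subtype _).sum_le_tsum _ fun j _ => norm_nonneg _
  have h3 : ∑ j ∈ ν.support.filter (fun j : 𝕁 => J₀ < (j : ℕ)), amin / 4 * ((ν j : ℝ) / normF J₀ ν) ≤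
      amin / 4 := by
    rw [← Finset.mul_sum, ← Finset.sum_div]
    refine mul_le_of_le_one_right (by positivity) (div_le_one_of_le₀ ?_ (by positivity))
    rw [normF]
    push_cast
    exact le_rfl
  have h4 : amin * K / (24 * (1 + K)) ≤ amin / 24 := by
    rw [div_le_div_iff₀ (by positivity) (by norm_num)]
    nlinarith
  calc _ ≤ ∑ j ∈ ν.support, (K * ‖ψ j‖ +
        if J₀ < (j : ℕ) then ‖ψ j‖ + amin / 4 * ((ν j : ℝ) / normF J₀ ν) else 0) :=
        Finset.sum_le_sum fun j _ => radius_mul_norm_le hα hK0 ν j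
    _ = K * ∑ j ∈ ν.support, ‖ψ j‖ + (∑ j ∈ ν.support.filter (fun j : 𝕁 => J₀ < (j : ℕ)), ‖ψ j‖ +
        ∑ j ∈ ν.support.filter (fun j : 𝕁 => J₀ < (j : ℕ)), amin / 4 * ((ν j : ℝ) / normF J₀ ν)) := by
        rw [Finset.sum_add_distrib, ← Finset.mul_sum, ← Finset.sum_filter, Finset.sum_add_distrib]
    _ ≤ K * ∑' j, ‖ψ j‖ + (amin / 24 + amin / 4) := by
        gcongr
        exact h2.trans (hJ₀.le.trans h4)
    _ ≤ amin / 2 := by linarith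

end PosteriorDecay

end BayesElliptic

theorem proposition5p1 {d n : ℕ} (hd : 0 < d)
    (D : Set (EuclideanSpace ℝ (Fin d))) (hDopen : IsOpen D) (hDbdd : Bornology.IsBounded D)
    (f : BayesElliptic.H10 D →L[ℝ] ℝ) (o : Fin n → (BayesElliptic.H10 D →L[ℝ] ℝ))
    (Γ : Matrix (Fin n) (Fin n) ℝ) (hΓ : Γ.PosDef) (δ : Fin n → ℝ)
    (𝕁 : Set ℕ) (abar : BayesElliptic.LInf D) (ψ : 𝕁 → BayesElliptic.LInf D)
    (hψ : Summable fun j => ‖ψ j‖)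
    (amin amax : ℝ) (hUEA : BayesElliptic.UEA abar ψ amin amax)
    (K : ℝ) (hK0 : 0 < K) (hK1 : K < 1) (hK : K * ∑' j, ‖ψ j‖ < amin / 8)
    (J₀ : ℕ)
    (hJ₀ : ∑' j : {j : 𝕁 // J₀ < (j : ℕ)}, ‖ψ j‖ < amin * K / (24 * (1 + K))) :
    ∃ C : ℝ, 0 < C ∧ ∀ ν : 𝕁 →₀ ℕ,
      MeasureTheory.IntegrableOn
        (fun y => BayesElliptic.posterior f o Γ δ abar ψ y * BayesElliptic.legendreTensor ν y)
        (BayesElliptic.paramBox 𝕁) (BayesElliptic.prior 𝕁) ∧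
      |BayesElliptic.legendreCoeff (BayesElliptic.posterior f o Γ δ abar ψ) ν| ≤
        C * ∏ m ∈ ν.support,
          (2 * (1 + K) / K * (BayesElliptic.eta ψ amin K J₀ ν m ^ ν m)⁻¹) ∧
      -- the degenerate case of an infinite radius
      ((∃ m ∈ ν.support, J₀ < (m : ℕ) ∧ ψ m = 0) →
        BayesElliptic.legendreCoeff (BayesElliptic.posterior f o Γ δ abar ψ) ν = 0)
 := by
  have hα := hUEA.1
  obtain ⟨M, hM0, hM⟩ :=
    BayesElliptic.exists_posterior_bound hd hDbdd f o Γ δ abar ψ hψ hUEA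
  refine ⟨M, hM0, fun ν => ?_⟩
  have hKr : ∀ m, K ≤ BayesElliptic.radius ψ amin K J₀ ν m :=
    BayesElliptic.le_radius hα hK1 ν
  classical
  -- Inactive variables stay real, so the constraint on the radii is a finite sum over `supp ν`.
  -- When `ψ_m = 0`, division by zero makes a tail radius `1`, which is still admissible.
  set ρ : 𝕁 → ℝ := fun j => if j ∈ ν.support then BayesElliptic.radius ψ amin K J₀ ν j else 0
    with hρ
  have hρS : ∀ j ∈ ν.support, ρ j = BayesElliptic.radius ψ amin K J₀ ν j := fun j hj => if_pos hj
  have hρ0 : ∀ j ∉ ν.support, ρ j * ‖ψ j‖ = 0 := fun j hj => by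
    rw [hρ]; simp only [if_neg hj, zero_mul]
  have hρnn : ∀ j, 0 ≤ ρ j := fun j => by
    simp only [hρ]
    split_ifs
    · exact hK0.le.trans (hKr j)
    · exact le_rfl
  obtain ⟨h1, h2, h3⟩ := hM ρ hρnn (summable_of_ne_finset_zero hρ0) (by
    rw [tsum_eq_sum hρ0, Finset.sum_congr rfl fun j hj => by rw [hρS j hj]]
    exact BayesElliptic.sum_radius_mul_norm_le hψ hα hK0 hK hJ₀ ν) ν fun j hj => by
      rw [hρS j hj]; exact hK0.trans_le (hKr j)
  refine ⟨h1, h2.trans (mul_le_mul_of_nonneg_left (Finset.prod_le_prod (fun j hj => ?_)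
    fun j hj => ?_) hM0.le), fun ⟨m, hm, _, hψm⟩ => h3 ⟨m, hm, hψm⟩⟩
  · have := BayesElliptic.one_add_le_semiAxisSum (ρ j)
    have hj0 : 0 < ρ j := by rw [hρS j hj]; exact hK0.trans_le (hKr j)
    have h4 : 0 < BayesElliptic.semiAxisSum (ρ j) - 1 := by linarith
    have h5 : 0 < BayesElliptic.semiAxisSum (ρ j) := by linarith
    unfold BayesElliptic.legendreDecay
    positivity
  · rw [hρS j hj]
    exact BayesElliptic.legendreDecay_le hK0 (hKr j) (ν j)
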